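/- All graphs are finite and simple. For a graph $G$ with at least one vertex, write $d(G)=2|E(G)|/|V(G)|$ for its average degree and $\Delta(G)$ for its maximum degree; a graph is called $H$-free if it has no (not necessarily induced) subgraph isomorphic to $H$. There exists an absolute constant $C>0$ such that the following holds for all integers $s,k\ge 2$, all real $d\ge 2$ and all real $\delta\in(0,1/20)$ with $d\ge (k/\delta)^{Cs^3/\delta}$. Let $G$ be a $K_{s,s}$-free graph with $d(G)\ge d$. Then $G$ has an induced subgraph $G'$ which is both $C_3$-free and $C_4$-free, satisfies $d(G')\ge k$, and for which at least one of the following holds: 1. $d(G')\ge \Delta(G')^{1-\delta}$; 2. $G'$ is bipartite. Furthermore, if $\Delta(G)\le d\,2^{d^{\delta/(1000s)}}$, then $G'$ (induced, $C_3$-free, $C_4$-free, with $d(G')\ge k$) can be chosen so that the first alternative $d(G')\ge \Delta(G')^{1-\delta}$ holds. -/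

import Mathlib

namespace SimpleGraph

/-- The average degree `2 e(G) / |V(G)|` of a finite graph. -/
noncomputable def avgDeg {V : Type*} [Fintype V] (G : SimpleGraph V) : ℝ :=
  2 * (G.edgeSet.ncard : ℝ) / (Fintype.card V : ℝ)

open Classical in
/-- The maximum degree of a finite graph. -/
noncomputable def maxDeg {V : Type*} [Fintype V] (G : SimpleGraph V) : ℕ :=
  G.maxDegree

/-- `G` contains neither a triangle nor a 4-cycle as a (not necessarily induced) subgraph. -/
def C3C4Free {V : Type*} (G : SimpleGraph V) : Prop :=
  (cycleGraph 3).Free G ∧ (cycleGraph 4).Free G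

end SimpleGraph

/-! Pass to a vertex set `X` whose induced average degree `d` is maximal: then every subset spans
average degree at most `d`. Put `Q = d ^ (δ / (1000 s))`, a tiny power of `d` that still exceeds a
huge power of `k / δ`, and `D = d Q ^ 10`. By maximality the few vertices of degree above `D` span
few edges among themselves, which leaves two cases (`exists_almost_regular_or`).

Almost regular case: there is an induced subgraph with maximum and average degree within a factor `Q
^ O(1)`. It consists either of the vertices of degree at most `D`, or of a balanced sample between
them and one of the `O(Q)` dyadic classes of degrees up to `d 2 ^ Q`. By Kővári–Sós–Turán, sets of
size at most the maximum degree `Δ` have only `O(Δ ^ (2 - 1 / s))` edges between them, so triangles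
and 4-cycles are rare. A random induced subgraph of degree about `Δ ^ (1 / (3 s))` loses little when
they are deleted (`exists_C3C4_sparse`), and the factor `Q ^ O(1)` is absorbed by the exponent `δ`.

Unbalanced case: many edges join vertices of degree at most `D` to vertices of degree above `d 2 ^
Q`. Repeatedly fixing one more common neighbour either yields many low vertices with `k` independent
neighbours of small pairwise codegree, or builds a `K_{s,s}` (`exists_spread_family`). Sampling the
huge side and discarding conflicting low vertices leaves a bipartite graph in which every low vertex
has degree `k` and the low side is the larger one (`exists_bipartite_of_spread`). The gap `2 ^ Q`
pays for all polynomial losses in `d`. A bound on `Δ(G)` excludes this case. -/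

namespace SimpleGraph

open Finset
open scoped Classical

/-! ### Random vertex subsets and the first-moment method -/

section Sampling

variable {V ι : Type*} [Fintype V]

/-- The probability that a random subset of `V`, containing each vertex independently with
probability `p`, equals `S`. -/
noncomputable def bernoulliWeight (p : ℝ) (S : Finset V) : ℝ := p ^ #S * (1 - p) ^ #(univ \ S)

lemma bernoulliWeight_nonneg {p : ℝ} (h0 : 0 ≤ p) (h1 : p ≤ 1) (S : Finset V) :
    0 ≤ bernoulliWeight p S :=
  mul_nonneg (pow_nonneg h0 _) (pow_nonneg (sub_nonneg.2 h1) _)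

/-- Expand the product over `i` of `p + (1 - p) [i ∉ T]`: its factors are `p` on `T` and `1`
elsewhere, and the terms of the expansion with `T ⊄ S` vanish. -/
lemma sum_bernoulliWeight_superset (p : ℝ) (T : Finset V) :
    ∑ S : Finset V, bernoulliWeight p S * (if T ⊆ S then 1 else 0) = p ^ #T := by
  have h := Finset.prod_add (fun _ : V => p) (fun i => if i ∈ T then 0 else 1 - p) univ
  have h1 : ∏ i : V, (p + if i ∈ T then 0 else 1 - p) = p ^ #T := by
    rw [← Finset.prod_subset (Finset.subset_univ T)]
    · rw [← Finset.prod_const]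
      exact Finset.prod_congr rfl fun i hi => by simp [hi]
    · intro i _ hi
      simp [hi]
  rw [h1, Finset.powerset_univ] at h
  rw [h]
  refine Finset.sum_congr rfl fun S _ => ?_
  rw [bernoulliWeight, Finset.prod_const]
  split_ifs with hTS
  · rw [mul_one]
    congr 1
    rw [← Finset.prod_const]
    refine Finset.prod_congr rfl fun i hi => ?_
    have : i ∉ T := fun h => (Finset.mem_sdiff.1 hi).2 (hTS h)
    simp [this]
  · obtain ⟨i, hiT, hiS⟩ := Finset.not_subset.1 hTS
    rw [Finset.prod_eq_zero (i := i) (by simp [hiS]) (by simp [hiT])]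
    simp

/-- The expectation of a function of a random subset of `V`. -/
noncomputable def expectation (p : ℝ) (f : Finset V → ℝ) : ℝ :=
  ∑ S : Finset V, bernoulliWeight p S * f S

lemma expectation_sub (p : ℝ) (f g : Finset V → ℝ) :
    expectation p (fun S => f S - g S) = expectation p f - expectation p g := by
  simp [expectation, mul_sub, Finset.sum_sub_distrib]

lemma expectation_const_mul (p c : ℝ) (f : Finset V → ℝ) :
    expectation p (fun S => c * f S) = c * expectation p f := by
  simp only [expectation, Finset.mul_sum]
  exact Finset.sum_congr rfl fun S _ => by ring

lemma expectation_const (p c : ℝ) : expectation (V := V) p (fun _ => c) = c := by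
  have h := sum_bernoulliWeight_superset p (∅ : Finset V)
  simp only [Finset.empty_subset, if_true, mul_one, Finset.card_empty, pow_zero] at h
  rw [expectation, ← Finset.sum_mul, h, one_mul]

/-- Linearity of expectation. The index set `J` lets edges, ordered pairs and rooted cycles be
counted with multiplicity. -/
lemma expectation_card_filter (p : ℝ) (J : Finset ι) (T : ι → Finset V) :
    expectation p (fun S => (#(J.filter fun j => T j ⊆ S) : ℝ)) = ∑ j ∈ J, p ^ #(T j) := by
  simp only [expectation, Finset.card_filter, Nat.cast_sum, Finset.mul_sum]
  rw [Finset.sum_comm]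
  refine Finset.sum_congr rfl fun j _ => ?_
  rw [← sum_bernoulliWeight_superset p (T j)]
  exact Finset.sum_congr rfl fun S _ => by split_ifs <;> simp

lemma exists_expectation_le {p : ℝ} (h0 : 0 ≤ p) (h1 : p ≤ 1) (f : Finset V → ℝ) :
    ∃ S, expectation p f ≤ f S := by
  by_contra! h
  have hlt : expectation p f < expectation (V := V) p (fun _ => expectation p f) := by
    refine Finset.sum_lt_sum
      (fun S _ => mul_le_mul_of_nonneg_left (h S).le (bernoulliWeight_nonneg h0 h1 S)) ?_
    -- Strictness needs one positive weight, and there is one because the weights sum to `1`.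
    by_contra! h3
    have h4 : ∀ S : Finset V, bernoulliWeight p S = 0 := by
      intro S
      have := h3 S (Finset.mem_univ _)
      by_contra hne
      have hpos := lt_of_le_of_ne (bernoulliWeight_nonneg h0 h1 S) (Ne.symm hne)
      exact absurd (mul_lt_mul_of_pos_left (h S) hpos) (not_lt.2 this)
    have := expectation_const (V := V) p 1
    simp [expectation, h4] at this
  rw [expectation_const] at hlt
  exact lt_irrefl _ hlt

end Sampling

/-! ### Greedy independent sets -/

section Independent

variable {V : Type*}

/-- Greedy independent sets: a symmetric relation with at most `q` neighbours per point has an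
independent set containing at least a `1 / (q + 1)` proportion of the points. -/
lemma exists_independent_of_degree_le {r : V → V → Prop} (hr : ∀ v w, r v w → r w v) {q : ℝ}
    (M : Finset V) (h : ∀ v ∈ M, (#(M.filter fun w => w ≠ v ∧ r v w) : ℝ) ≤ q) :
    ∃ I ⊆ M, (#M : ℝ) ≤ (q + 1) * #I ∧ ∀ v ∈ I, ∀ w ∈ I, v ≠ w → ¬ r v w := by
  induction M using Finset.strongInduction with
  | H M ih =>
    rcases M.eq_empty_or_nonempty with rfl | ⟨v, hv⟩
    · exact ⟨∅, by simp, by simp, by simp⟩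
    set N := M.filter fun w => w ≠ v ∧ r v w with hN
    set M' := M \ insert v N with hM'
    have hsub : M' ⊂ M := by
      refine Finset.ssubset_iff_subset_ne.2 ⟨Finset.sdiff_subset, fun he => ?_⟩
      have : v ∈ M' := he ▸ hv
      simp [hM'] at this
    obtain ⟨I, hIM, hcard, hind⟩ := ih M' hsub fun w hw => by
      refine le_trans ?_ (h w (hsub.1 hw))
      exact_mod_cast Finset.card_le_card (Finset.filter_subset_filter _ hsub.1)
    have hvI : v ∉ I := fun hvI => by
      have := hIM hvI
      simp [hM'] at this
    have hIr : ∀ w ∈ I, ¬ r v w := fun w hw hvw => by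
      have h1 := hIM hw
      have h2 : w ≠ v := fun e => hvI (e ▸ hw)
      simp only [hM', Finset.mem_sdiff, Finset.mem_insert, hN, Finset.mem_filter] at h1
      exact h1.2 (Or.inr ⟨h1.1, h2, hvw⟩)
    refine ⟨insert v I, ?_, ?_, ?_⟩
    · exact Finset.insert_subset hv (hIM.trans hsub.1)
    · have h1 : #M ≤ #M' + (#N + 1) := by
        have h2 : #M ≤ #M' + #(insert v N) := Finset.card_le_card_sdiff_add_card
        have h3 := Finset.card_insert_le v N
        omega
      have h2 : (#M : ℝ) ≤ #M' + (#N + 1) := by exact_mod_cast h1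
      have h3 := h v hv
      rw [Finset.card_insert_of_notMem hvI]
      push_cast
      nlinarith
    · intro a ha b hb hab
      rcases Finset.mem_insert.1 ha with rfl | ha' <;>
        rcases Finset.mem_insert.1 hb with rfl | hb'
      · exact absurd rfl hab
      · exact hIr b hb'
      · exact fun h => hIr a ha' (hr _ _ h)
      · exact hind a ha' b hb' hab

end Independent

/-! ### Neighbourhoods and the Kővári–Sós–Turán bound -/

section Bicliques

variable {V : Type*} (G : SimpleGraph V)

/-- The neighbours of `v` in the finite set `X`. -/
noncomputable def nbrs (X : Finset V) (v : V) : Finset V := X.filter (G.Adj v)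

/-- The common neighbours of `T` in the finite set `A`. -/
noncomputable def commonNbrs (A T : Finset V) : Finset V := A.filter fun a => ∀ b ∈ T, G.Adj a b

/-- `G` has no complete bipartite subgraph with `s` vertices on each side. -/
def NoBiclique (s : ℕ) : Prop :=
  ∀ T U : Finset V, #T = s → #U = s → ¬ ∀ t ∈ T, ∀ u ∈ U, G.Adj t u

variable {G}

@[simp] lemma mem_nbrs {X : Finset V} {v w : V} : w ∈ G.nbrs X v ↔ w ∈ X ∧ G.Adj v w := by
  simp [nbrs]

@[simp] lemma mem_commonNbrs {A T : Finset V} {a : V} :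
    a ∈ G.commonNbrs A T ↔ a ∈ A ∧ ∀ b ∈ T, G.Adj a b := by
  simp [commonNbrs]

lemma nbrs_mono {X Y : Finset V} (h : X ⊆ Y) (v : V) : G.nbrs X v ⊆ G.nbrs Y v :=
  Finset.filter_subset_filter _ h

lemma card_nbrs_mono {X Y : Finset V} (h : X ⊆ Y) (v : V) :
    (#(G.nbrs X v) : ℝ) ≤ #(G.nbrs Y v) := by
  exact_mod_cast Finset.card_le_card (nbrs_mono h v)

lemma sum_card_nbrs_comm (X Y : Finset V) :
    ∑ x ∈ X, #(G.nbrs Y x) = ∑ y ∈ Y, #(G.nbrs X y) := by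
  simp only [nbrs, Finset.card_filter]
  rw [Finset.sum_comm]
  exact Finset.sum_congr rfl fun y _ => Finset.sum_congr rfl fun x _ => by simp [G.adj_comm]

lemma NoBiclique.card_commonNbrs_lt {s : ℕ} (hG : G.NoBiclique s) (A T : Finset V) (hT : #T = s) :
    #(G.commonNbrs A T) < s := by
  by_contra! h
  obtain ⟨U, hU, hUs⟩ := Finset.exists_subset_card_eq h
  exact hG U T hUs hT fun u hu t ht => (mem_commonNbrs.1 (hU hu)).2 t ht

/-- The Kővári–Sós–Turán double count. -/
lemma NoBiclique.sum_pow_le {s : ℕ} (hG : G.NoBiclique s) (X Y : Finset V) :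
    ∑ x ∈ X, (#(G.nbrs Y x) + 1 - s) ^ s ≤ s * #Y ^ s := by
  -- Count pairs of `x` and an `s`-subset of its neighbourhood. The truncated `deg + 1 - s` then
  -- enters through `(n + 1 - s) ^ s ≤ n (n - 1) ⋯ (n - s + 1)`.
  have h1 : ∑ x ∈ X, (#(G.nbrs Y x)).choose s ≤ s * (#Y).choose s := by
    have h2 : ∀ x ∈ X, (#(G.nbrs Y x)).choose s
        = ∑ T ∈ Y.powersetCard s, if ∀ b ∈ T, G.Adj x b then 1 else 0 := by
      intro x _
      rw [← Finset.card_powersetCard, ← Finset.card_filter]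
      congr 1
      ext T
      simp only [Finset.mem_powersetCard, Finset.mem_filter, Finset.subset_iff, mem_nbrs]
      constructor
      · exact fun h => ⟨⟨fun t ht => (h.1 ht).1, h.2⟩, fun t ht => (h.1 ht).2⟩
      · exact fun h => ⟨fun t ht => ⟨h.1.1 ht, h.2 t ht⟩, h.1.2⟩
    rw [Finset.sum_congr rfl h2, Finset.sum_comm, mul_comm, ← Finset.card_powersetCard,
      ← smul_eq_mul]
    refine Finset.sum_le_card_nsmul _ _ _ fun T hT => ?_
    rw [← Finset.card_filter]
    exact (hG.card_commonNbrs_lt X T (Finset.mem_powersetCard.1 hT).2).le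
  calc ∑ x ∈ X, (#(G.nbrs Y x) + 1 - s) ^ s
      ≤ ∑ x ∈ X, s.factorial * (#(G.nbrs Y x)).choose s :=
        Finset.sum_le_sum fun x _ => by
          rw [← Nat.descFactorial_eq_factorial_mul_choose]
          exact Nat.pow_sub_le_descFactorial _ _
    _ ≤ s.factorial * (s * (#Y).choose s) := by
        rw [← Finset.mul_sum]
        exact Nat.mul_le_mul_left _ h1
    _ = s * (#Y).descFactorial s := by
        rw [Nat.descFactorial_eq_factorial_mul_choose]
        ring
    _ ≤ s * #Y ^ s := Nat.mul_le_mul_left _ (Nat.descFactorial_le_pow _ _)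

/-- Kővári–Sós–Turán: between two sets of at most `M` vertices there are `O(M ^ (2 - 1 / s))`
edges. -/
lemma NoBiclique.sum_card_nbrs_le {s : ℕ} (hs : 1 ≤ s) (hG : G.NoBiclique s) {X Y : Finset V}
    {M z : ℝ} (hz : 0 < z) (hzM : z ^ s ≤ M) (hsz : s * z ≤ M) (hX : (#X : ℝ) ≤ M)
    (hY : (#Y : ℝ) ≤ M) : ∑ x ∈ X, (#(G.nbrs Y x) : ℝ) ≤ 3 * M ^ 2 / z := by
  have hM : 0 < M := lt_of_lt_of_le (pow_pos hz s) hzM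
  set y : V → ℕ := fun x => #(G.nbrs Y x) + 1 - s with hy
  obtain ⟨t, rfl⟩ : ∃ t, s = t + 1 := ⟨s - 1, by omega⟩
  -- Power mean inequality; `s ≤ 2 ^ s` and `z ^ s ≤ M` absorb the constants. The shift by `s` in
  -- `y` is later paid for by `s * z ≤ M`.
  have h1 : (∑ x ∈ X, (y x : ℝ)) ^ (t + 1) ≤ (2 * M ^ 2 / z) ^ (t + 1) := by
    rcases X.eq_empty_or_nonempty with rfl | hne
    · simp; positivity
    have h2 := pow_sum_div_card_le_sum_pow (s := X) (f := fun x => (y x : ℝ))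
      (fun x _ => by positivity) t
    have h3 : (∑ x ∈ X, (y x : ℝ) ^ (t + 1)) ≤ ((t + 1 : ℕ) : ℝ) * (#Y : ℝ) ^ (t + 1) := by
      exact_mod_cast hG.sum_pow_le X Y
    have h4 : (0 : ℝ) < #X := by exact_mod_cast hne.card_pos
    rw [div_le_iff₀ (by positivity)] at h2
    have h5 : ((t + 1 : ℕ) : ℝ) ≤ 2 ^ (t + 1) := by exact_mod_cast Nat.lt_two_pow_self.le
    calc (∑ x ∈ X, (y x : ℝ)) ^ (t + 1)
        ≤ (∑ x ∈ X, (y x : ℝ) ^ (t + 1)) * (#X : ℝ) ^ t := h2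
      _ ≤ (2 ^ (t + 1) * M ^ (t + 1)) * M ^ t := by gcongr; exact h3.trans (by gcongr)
      _ ≤ (2 * M ^ 2 / z) ^ (t + 1) := by
          rw [div_pow, le_div_iff₀ (by positivity)]
          calc 2 ^ (t + 1) * M ^ (t + 1) * M ^ t * z ^ (t + 1)
              ≤ 2 ^ (t + 1) * M ^ (t + 1) * M ^ t * M := by gcongr
            _ = (2 * M ^ 2) ^ (t + 1) := by rw [mul_pow, ← pow_mul]; ring
  have h6 : ∑ x ∈ X, (y x : ℝ) ≤ 2 * M ^ 2 / z :=
    le_of_pow_le_pow_left₀ (by omega) (by positivity) h1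
  have h7 : ∑ x ∈ X, (#(G.nbrs Y x) : ℝ) ≤ ∑ x ∈ X, ((y x : ℝ) + (t + 1 : ℕ)) := by
    refine Finset.sum_le_sum fun x _ => ?_
    have : #(G.nbrs Y x) ≤ y x + (t + 1) := by simp only [hy]; omega
    exact_mod_cast this
  have h8 : (#X : ℝ) * (t + 1 : ℕ) ≤ M ^ 2 / z := by
    rw [le_div_iff₀ hz]
    calc (#X : ℝ) * (t + 1 : ℕ) * z = #X * ((t + 1 : ℕ) * z) := by ring
      _ ≤ M * M := by gcongr
      _ = M ^ 2 := by ring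
  rw [Finset.sum_add_distrib, Finset.sum_const, nsmul_eq_mul] at h7
  calc _ ≤ _ := h7
    _ ≤ 2 * M ^ 2 / z + M ^ 2 / z := add_le_add h6 h8
    _ = 3 * M ^ 2 / z := by ring

end Bicliques

/-! ### Low vertices with many heavy neighbours of small pairwise codegree -/

section Spread

variable {V : Type*} {G : SimpleGraph V}

variable (G) in
/-- The vertices of `X` outside `T` whose addition to `T` leaves at least `Δ` common neighbours
in `A`. -/
noncomputable def heavy (A T : Finset V) (Δ : ℝ) (X : Finset V) : Finset V :=
  X.filter fun b => b ∉ T ∧ Δ ≤ #(G.commonNbrs A (insert b T))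

lemma mem_heavy {A T X : Finset V} {Δ : ℝ} {b : V} :
    b ∈ G.heavy A T Δ X ↔ b ∈ X ∧ b ∉ T ∧ Δ ≤ #(G.commonNbrs A (insert b T)) := by
  simp [heavy]

/-- Each common neighbour of `T` is counted once for each of its at most `D` neighbours in `B`. -/
lemma sum_card_commonNbrs_insert_le {A B T : Finset V} {D : ℝ}
    (hD : ∀ a ∈ A, (#(G.nbrs B a) : ℝ) ≤ D) :
    ∑ b ∈ B, (#(G.commonNbrs A (insert b T)) : ℝ) ≤ D * #(G.commonNbrs A T) := by
  have h1 : ∀ b ∈ B, #(G.commonNbrs A (insert b T)) = #(G.nbrs (G.commonNbrs A T) b) := by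
    intro b _
    congr 1
    ext a
    simp only [mem_commonNbrs, mem_nbrs, Finset.forall_mem_insert, G.adj_comm a b]
    tauto
  have h2 : ∑ b ∈ B, (#(G.commonNbrs A (insert b T)) : ℝ)
      = ∑ a ∈ G.commonNbrs A T, (#(G.nbrs B a) : ℝ) := by
    rw [Finset.sum_congr rfl fun b hb => by rw [h1 b hb]]
    exact_mod_cast sum_card_nbrs_comm B (G.commonNbrs A T)
  rw [h2, mul_comm, ← nsmul_eq_mul]
  exact Finset.sum_le_card_nsmul _ _ _ fun a ha => hD a (mem_commonNbrs.1 ha).1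

/-- Either many of the given vertices have `k` heavy neighbours that pairwise extend `T` to sets with few
common neighbours, or `T` can be enlarged so that many vertices keep many heavy neighbours. -/
lemma spread_step {k : ℕ} (hk : 1 ≤ k) {A B T A' : Finset V} {I : V → Finset V}
    {D w m Δ Δ' : ℝ} (hD0 : 0 < D) (hw0 : 0 ≤ w) (hD : ∀ a ∈ A, (#(G.nbrs B a) : ℝ) ≤ D)
    (hIB : ∀ a ∈ A', I a ⊆ G.nbrs B a) (hA' : A' ⊆ G.commonNbrs A T) (hne : A'.Nonempty)
    (hw : (#(G.commonNbrs A T) : ℝ) ≤ w * #A')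
    (hM : ∀ a ∈ A', m ≤ #(G.heavy A T Δ (I a))) (hm : 2 * k ≤ m) :
    (∃ A'' ⊆ A', A''.Nonempty ∧ (#A' : ℝ) ≤ 2 * #A'' ∧ ∀ a ∈ A'', ∃ S ⊆ G.heavy A T Δ (I a),
      #S = k ∧ ∀ b ∈ S, ∀ b' ∈ S, b ≠ b' →
        (#(G.commonNbrs A (insert b (insert b' T))) : ℝ) < Δ') ∨
    (∃ b ∈ B, b ∉ T ∧ ∃ A'' ⊆ A', A'' ⊆ G.commonNbrs A (insert b T) ∧ A''.Nonempty ∧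
      (#(G.commonNbrs A (insert b T)) : ℝ) ≤ w * (2 * D) * #A'' ∧
      ∀ a ∈ A'', m / (2 * k) ≤ #(G.heavy A (insert b T) Δ' (I a))) := by
  set P : V → Prop := fun a => ∃ S ⊆ G.heavy A T Δ (I a),
      #S = k ∧ ∀ b ∈ S, ∀ b' ∈ S, b ≠ b' →
        (#(G.commonNbrs A (insert b (insert b' T))) : ℝ) < Δ' with hP
  have hkR : (1 : ℝ) ≤ k := by exact_mod_cast hk
  have hA'0 : 0 < #A' := hne.card_pos
  have hsplit : #(A'.filter P) + #(A'.filter fun a => ¬ P a) = #A' :=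
    Finset.card_filter_add_card_filter_not _
  by_cases hc : #A' ≤ 2 * #(A'.filter P)
  · left
    refine ⟨A'.filter P, Finset.filter_subset _ _, ?_, by exact_mod_cast hc,
      fun a ha => (Finset.mem_filter.1 ha).2⟩
    rw [← Finset.card_pos]
    omega
  right
  set N := A'.filter fun a => ¬ P a with hN
  have hNA : N ⊆ A' := Finset.filter_subset _ _
  have hN2 : (#A' : ℝ) ≤ 2 * #N := by
    have : #A' ≤ 2 * #N := by omega
    exact_mod_cast this
  have hNne : N.Nonempty := by
    rw [← Finset.card_pos]
    omega
  -- Otherwise the relation of having joint codegree at least `Δ'` with `T` has degrees below `m /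
  -- (2k)` on the heavy neighbours of `a`. As `m ≥ 2k`, the greedy bound gives `k` unrelated ones,
  -- contradicting `¬ P a`.
  have hex : ∀ a ∈ N, ∃ b ∈ G.heavy A T Δ (I a),
      m / (2 * k) ≤ #(G.heavy A (insert b T) Δ' (I a)) := by
    intro a ha
    by_contra! hcon
    obtain ⟨J, hJ, hJc, hJi⟩ := exists_independent_of_degree_le
      (r := fun b b' => Δ' ≤ #(G.commonNbrs A (insert b (insert b' T))))
      (fun v u h => by rwa [Finset.insert_comm]) (q := m / (2 * k)) (G.heavy A T Δ (I a))
      (fun b hb => by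
        refine le_trans ?_ (hcon b hb).le
        have : ((G.heavy A T Δ (I a)).filter fun u => u ≠ b ∧
            Δ' ≤ #(G.commonNbrs A (insert b (insert u T)))) ⊆ G.heavy A (insert b T) Δ' (I a) := by
          intro u hu
          simp only [Finset.mem_filter, mem_heavy, Finset.mem_insert, not_or] at hu ⊢
          refine ⟨hu.1.1, ⟨hu.2.1, hu.1.2.1⟩, ?_⟩
          rw [Finset.insert_comm]
          exact hu.2.2
        exact_mod_cast Finset.card_le_card this)
    have hkJ : k ≤ #J := by
      by_contra! hlt
      have h1 : (#J : ℝ) < k := by exact_mod_cast hlt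
      have h2 := (hM a (hNA ha)).trans hJc
      have hpos : (0 : ℝ) < m / (2 * k) + 1 := by
        have : 0 ≤ m := le_trans (by positivity) hm
        positivity
      have h3 : m < (m / (2 * k) + 1) * k := h2.trans_lt (mul_lt_mul_of_pos_left h1 hpos)
      have h4 : (m / (2 * k) + 1) * k = m / 2 + k := by field_simp
      linarith
    obtain ⟨S, hSJ, hSk⟩ := Finset.exists_subset_card_eq hkJ
    exact (Finset.mem_filter.1 ha).2 ⟨S, hSJ.trans hJ, hSk, fun b hb b' hb' hbb =>
      not_le.1 (hJi b (hSJ hb) b' (hSJ hb') hbb)⟩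
  choose! f hf hfm using hex
  have hfB : ∀ a ∈ N, f a ∈ B := fun a ha =>
    (mem_nbrs.1 (hIB a (hNA ha) (mem_heavy.1 (hf a ha)).1)).1
  have hfa : ∀ a ∈ N, G.Adj a (f a) := fun a ha =>
    (mem_nbrs.1 (hIB a (hNA ha) (mem_heavy.1 (hf a ha)).1)).2
  -- Weighted pigeonhole: the fibres of `f` partition `N`, while the sets of common neighbours have
  -- total size at most `D w (2 #N)`.
  have hb : ∃ b ∈ N.image f,
      (#(G.commonNbrs A (insert b T)) : ℝ) ≤ w * (2 * D) * #(N.filter fun a => f a = b) := by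
    by_contra! hcon
    have h1 : ∑ b ∈ N.image f, w * (2 * D) * (#(N.filter fun a => f a = b) : ℝ)
        < ∑ b ∈ N.image f, (#(G.commonNbrs A (insert b T)) : ℝ) :=
      Finset.sum_lt_sum_of_nonempty (hNne.image f) hcon
    have h2 : ∑ b ∈ N.image f, (#(G.commonNbrs A (insert b T)) : ℝ)
        ≤ ∑ b ∈ B, (#(G.commonNbrs A (insert b T)) : ℝ) :=
      Finset.sum_le_sum_of_subset_of_nonneg
        (fun b hb => by
          obtain ⟨a, ha, rfl⟩ := Finset.mem_image.1 hb
          exact hfB a ha)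
        (fun _ _ _ => by positivity)
    have h3 := sum_card_commonNbrs_insert_le (T := T) hD
    have h4 : ∑ b ∈ N.image f, (#(N.filter fun a => f a = b) : ℝ) = #N := by
      exact_mod_cast (Finset.card_eq_sum_card_image f N).symm
    rw [← Finset.mul_sum, h4] at h1
    have h5 : D * (#(G.commonNbrs A T) : ℝ) ≤ D * (w * (2 * #N)) := by
      gcongr
      exact hw.trans (by gcongr)
    linarith
  obtain ⟨b, hbN, hbc⟩ := hb
  obtain ⟨a, ha, rfl⟩ := Finset.mem_image.1 hbN
  refine ⟨f a, hfB a ha, (mem_heavy.1 (hf a ha)).2.1, N.filter fun a' => f a' = f a,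
    (Finset.filter_subset _ _).trans hNA, ?_, ⟨a, by simp [ha]⟩, hbc, ?_⟩
  · intro a' ha'
    obtain ⟨h1, h2⟩ := Finset.mem_filter.1 ha'
    have h3 := mem_commonNbrs.1 (hA' (hNA h1))
    simp only [mem_commonNbrs, Finset.forall_mem_insert]
    exact ⟨h3.1, h2 ▸ hfa a' h1, h3.2⟩
  · intro a' ha'
    obtain ⟨h1, h2⟩ := Finset.mem_filter.1 ha'
    exact h2 ▸ hfm a' h1

/-- Iterates `spread_step` from `T = ∅`. Each failure adds a vertex to `T`, divides the supply of
heavy neighbours by `2k` and costs a factor `2D` in density. The iteration cannot survive to `#T = s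
- 1`, since a further heavy vertex would complete a `K_{s,s}`. -/
lemma exists_spread_family {s k : ℕ} (hs : 1 ≤ s) (hk : 1 ≤ k) (hG : G.NoBiclique s)
    {A B A₀ : Finset V} {I : V → Finset V} {D w m : ℝ} {Δ : ℕ → ℝ}
    (hD0 : 0 < D) (hw0 : 0 ≤ w) (hD : ∀ a ∈ A, (#(G.nbrs B a) : ℝ) ≤ D)
    (hIB : ∀ a ∈ A₀, I a ⊆ G.nbrs B a) (hA₀ : A₀ ⊆ A) (hne : A₀.Nonempty)
    (hw : (#A : ℝ) ≤ w * #A₀) (hI : ∀ a ∈ A₀, m ≤ #(I a))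
    (hΔ : ∀ a ∈ A₀, ∀ b ∈ I a, Δ 0 ≤ #(G.nbrs A b)) (hm : ∀ t < s, 2 * k ≤ m / (2 * k) ^ t)
    (hΔs : s ≤ Δ (s - 1)) :
    ∃ t < s, ∃ T A'' : Finset V, A'' ⊆ G.commonNbrs A T ∧ A'' ⊆ A₀ ∧ A''.Nonempty ∧
      (#(G.commonNbrs A T) : ℝ) ≤ 2 * (w * (2 * D) ^ t) * #A'' ∧
      ∀ a ∈ A'', ∃ S ⊆ G.heavy A T (Δ t) (I a), #S = k ∧ ∀ b ∈ S, ∀ b' ∈ S, b ≠ b' →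
        (#(G.commonNbrs A (insert b (insert b' T))) : ℝ) < Δ (t + 1) := by
  by_contra hcon
  have key : ∀ t < s, ∃ T A' : Finset V, #T = t ∧ A' ⊆ G.commonNbrs A T ∧ A' ⊆ A₀ ∧
      A'.Nonempty ∧ (#(G.commonNbrs A T) : ℝ) ≤ w * (2 * D) ^ t * #A' ∧
      ∀ a ∈ A', m / (2 * k) ^ t ≤ #(G.heavy A T (Δ t) (I a)) := by
    intro t
    induction t with
    | zero =>
      intro _
      have hA : G.commonNbrs A ∅ = A := by ext; simp
      refine ⟨∅, A₀, rfl, by rwa [hA], subset_rfl, hne, by simpa [hA] using hw, fun a ha => ?_⟩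
      have : G.heavy A ∅ (Δ 0) (I a) = I a := by
        ext b
        simp only [mem_heavy, Finset.notMem_empty, not_false_eq_true, true_and, and_iff_left_iff_imp]
        intro hb
        refine (hΔ a ha b hb).trans ?_
        have h1 : G.nbrs A b ⊆ G.commonNbrs A (insert b ∅) := by
          intro x hx
          simpa [G.adj_comm] using hx
        exact_mod_cast Finset.card_le_card h1
      rw [this]
      simpa using hI a ha
    | succ t ih =>
      intro ht
      obtain ⟨T, A', hT, hA', hA'0, hne', hw', hM⟩ := ih (by omega)
      rcases spread_step hk (Δ' := Δ (t + 1)) hD0 (by positivity) hD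
        (fun a ha => hIB a (hA'0 ha)) hA' hne' hw' hM (hm t (by omega)) with h | h
      · obtain ⟨A'', h1, h2, h3, h4⟩ := h
        refine absurd ⟨t, by omega, T, A'', h1.trans hA', h1.trans hA'0, h2, ?_, h4⟩ hcon
        calc _ ≤ _ := hw'
          _ ≤ w * (2 * D) ^ t * (2 * #A'') := by gcongr
          _ = _ := by ring
      · obtain ⟨b, -, hbT, A'', h1, h2, h3, h4, h5⟩ := h
        refine ⟨insert b T, A'', by rw [Finset.card_insert_of_notMem hbT, hT], h2,
          h1.trans hA'0, h3, ?_, fun a ha => ?_⟩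
        · rw [pow_succ, ← mul_assoc]
          exact h4
        · rw [pow_succ, ← div_div]
          exact h5 a ha
  obtain ⟨T, A', hT, -, -, ⟨a, ha⟩, -, hM⟩ := key (s - 1) (by omega)
  have h1 : (0 : ℝ) < #(G.heavy A T (Δ (s - 1)) (I a)) := by
    refine lt_of_lt_of_le ?_ ((hm (s - 1) (by omega)).trans (hM a ha))
    positivity
  obtain ⟨b, hb⟩ := Finset.card_pos.1 (by exact_mod_cast h1)
  obtain ⟨-, hbT, hb2⟩ := mem_heavy.1 hb
  have h2 := hG.card_commonNbrs_lt A (insert b T)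
    (by rw [Finset.card_insert_of_notMem hbT, hT]; omega)
  have h3 : (s : ℝ) ≤ #(G.commonNbrs A (insert b T)) := hΔs.trans hb2
  exact absurd h2 (not_lt.2 (by exact_mod_cast h3))

end Spread

/-! ### From a spread family to an induced bipartite graph -/

section Extract

variable {V : Type*} [Fintype V] {G : SimpleGraph V}

/-- Sampling the heavy side and choosing a conflict-free subset of the other side yields an induced
bipartite graph without 4-cycles. -/
lemma exists_bipartite_of_spread {k : ℕ} {A₀ B₀ A₁ : Finset V} {S out : V → Finset V}
    {Δ Δ' D w q : ℝ} (hD : 1 ≤ D) (hw0 : 0 ≤ w) (hq : 0 ≤ q) (hΔ : 0 < Δ) (hΔ' : 0 ≤ Δ')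
    (hA₁ : A₁ ⊆ A₀) (hne : A₁.Nonempty) (hw : (#A₀ : ℝ) ≤ w * #A₁)
    (hB₀ : ∀ b ∈ B₀, Δ ≤ #(G.nbrs A₀ b))
    (hDB : ∀ a ∈ A₀, (#(G.nbrs B₀ a) : ℝ) ≤ D) (hDA : ∀ a ∈ A₀, (#(G.nbrs A₀ a) : ℝ) ≤ D)
    (hS : ∀ a ∈ A₁, S a ⊆ G.nbrs B₀ a) (hSk : ∀ a ∈ A₁, #(S a) = k)
    (hSi : ∀ a ∈ A₁, ∀ b ∈ S a, ∀ b' ∈ S a, ¬ G.Adj b b')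
    (hpair : ∀ a ∈ A₁, ∀ b ∈ S a, ∀ b' ∈ S a, b ≠ b' → (#(G.commonNbrs A₀ {b, b'}) : ℝ) ≤ Δ')
    (hout : ∀ b ∈ B₀, (#(out b) : ℝ) ≤ q) (houtadj : ∀ b ∈ B₀, ∀ b' ∈ out b, G.Adj b b')
    (horient : ∀ b ∈ B₀, ∀ b' ∈ B₀, G.Adj b b' → b' ∈ out b ∨ b ∈ out b')
    (hnum : 2 * (w * D) * (D + k ^ 2 * Δ' + 1) ≤ (1 / (2 * (D + k * q))) ^ k * Δ) :
    ∃ A' ⊆ A₁, ∃ B' ⊆ B₀, A'.Nonempty ∧ #B' ≤ #A' ∧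
      (∀ a ∈ A', ∀ a' ∈ A', ¬ G.Adj a a') ∧ (∀ b ∈ B', ∀ b' ∈ B', ¬ G.Adj b b') ∧
      (∀ a ∈ A', #(G.nbrs B' a) = k) ∧
      ∀ a ∈ A', ∀ a' ∈ A', a ≠ a' → ∀ b ∈ B', ∀ b' ∈ B', G.Adj a b → G.Adj a b' →
        G.Adj a' b → G.Adj a' b' → b = b' := by
  have hkq : 0 ≤ k * q := by positivity
  -- With this `p`, the at most `D + k q` forbidden vertices of `a` cost in expectation at most half
  -- of the probability `p ^ k` that `S a` is sampled.
  set p : ℝ := 1 / (2 * (D + k * q)) with hp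
  have hp0 : 0 < p := by positivity
  have hp1 : p ≤ 1 := by
    rw [hp, div_le_one (by positivity)]
    linarith
  -- Vertices the sample must avoid so that `a` keeps no neighbour outside `S a` and no vertex of `S
  -- a` is discarded for a sampled out-neighbour. Independence of `S a` makes this set disjoint from
  -- `S a`.
  set F : V → Finset V := fun a => (G.nbrs B₀ a \ S a) ∪ (S a).biUnion out with hF
  have hSB : ∀ a ∈ A₁, ∀ b ∈ S a, b ∈ B₀ := fun a ha b hb => (mem_nbrs.1 (hS a ha hb)).1
  have hFS : ∀ a ∈ A₁, ∀ x ∈ F a, x ∉ S a := by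
    intro a ha x hx hxS
    simp only [hF, Finset.mem_union, Finset.mem_sdiff, Finset.mem_biUnion] at hx
    rcases hx with hx | ⟨b, hb, hx⟩
    · exact hx.2 hxS
    · exact hSi a ha b hb x hxS (houtadj b (hSB a ha b hb) x hx)
  have hFc : ∀ a ∈ A₁, (#(F a) : ℝ) ≤ D + k * q := by
    intro a ha
    have h1 : (#(F a) : ℝ) ≤ #(G.nbrs B₀ a \ S a) + #((S a).biUnion out) := by
      exact_mod_cast Finset.card_union_le _ _
    have h2 : (#(G.nbrs B₀ a \ S a) : ℝ) ≤ D := by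
      refine le_trans ?_ (hDB a (hA₁ ha))
      exact_mod_cast Finset.card_le_card Finset.sdiff_subset
    have h3 : (#((S a).biUnion out) : ℝ) ≤ k * q := by
      calc (#((S a).biUnion out) : ℝ) ≤ ∑ b ∈ S a, (#(out b) : ℝ) := by
            exact_mod_cast Finset.card_biUnion_le
        _ ≤ #(S a) • q := Finset.sum_le_card_nsmul _ _ _ fun b hb => hout b (hSB a ha b hb)
        _ = k * q := by rw [hSk a ha, nsmul_eq_mul]
    linarith
  obtain ⟨S₀, hS₀⟩ := exists_expectation_le hp0.le hp1 fun S₀ : Finset V =>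
    (#(A₁.filter fun a => S a ⊆ S₀) : ℝ)
      - #((A₁.sigma F).filter fun j => insert j.2 (S j.1) ⊆ S₀)
  rw [expectation_sub, expectation_card_filter, expectation_card_filter, Finset.sum_sigma] at hS₀
  set A₂ := A₁.filter fun a => S a ⊆ S₀ ∧ Disjoint (F a) S₀ with hA₂
  have hA₂c : (#A₁ : ℝ) * p ^ k ≤ 2 * #A₂ := by
    have h1 : ∑ a ∈ A₁, p ^ #(S a) = #A₁ * p ^ k := by
      rw [Finset.sum_congr rfl fun a ha => by rw [hSk a ha], Finset.sum_const, nsmul_eq_mul]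
    have h2 : ∑ a ∈ A₁, ∑ x ∈ F a, p ^ #(insert x (S a)) ≤ #A₁ * (p ^ k / 2) := by
      rw [← nsmul_eq_mul]
      refine Finset.sum_le_card_nsmul _ _ _ fun a ha => ?_
      rw [Finset.sum_congr rfl fun x hx => by
        rw [Finset.card_insert_of_notMem (hFS a ha x hx), hSk a ha], Finset.sum_const, nsmul_eq_mul]
      calc (#(F a) : ℝ) * p ^ (k + 1) ≤ (D + k * q) * p ^ (k + 1) := by
            gcongr
            exact hFc a ha
        _ = p ^ k * ((D + k * q) * p) := by ring
        _ = p ^ k / 2 := by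
            rw [hp]
            have : D + k * q ≠ 0 := by positivity
            field_simp
    have h3 : #(A₁.filter fun a => S a ⊆ S₀)
        ≤ #A₂ + #((A₁.sigma F).filter fun j => insert j.2 (S j.1) ⊆ S₀) := by
      refine le_trans (Finset.card_le_card (t := A₂ ∪
        ((A₁.sigma F).filter fun j => insert j.2 (S j.1) ⊆ S₀).image Sigma.fst) ?_)
        ((Finset.card_union_le _ _).trans (by gcongr; exact Finset.card_image_le))
      intro a ha
      obtain ⟨h4, h5⟩ := Finset.mem_filter.1 ha
      by_cases hd : Disjoint (F a) S₀
      · exact Finset.mem_union_left _ (by simp [hA₂, h4, h5, hd])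
      · obtain ⟨x, hx, hxS⟩ := Finset.not_disjoint_iff.1 hd
        refine Finset.mem_union_right _ (Finset.mem_image.2 ⟨⟨a, x⟩, ?_, rfl⟩)
        simp only [Finset.mem_filter, Finset.mem_sigma]
        exact ⟨⟨h4, hx⟩, Finset.insert_subset hxS h5⟩
    have h3' : (#(A₁.filter fun a => S a ⊆ S₀) : ℝ)
        ≤ #A₂ + #((A₁.sigma F).filter fun j => insert j.2 (S j.1) ⊆ S₀) := by exact_mod_cast h3
    linarith
  have hA₂A : A₂ ⊆ A₁ := Finset.filter_subset _ _
  -- Every edge inside `B₀` is oriented at one of its ends, so this set is independent.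
  set B' := B₀.filter fun b => b ∈ S₀ ∧ Disjoint (out b) S₀ with hB'
  have hB'S : ∀ a ∈ A₂, G.nbrs B' a = S a := by
    intro a ha
    obtain ⟨ha1, haS, haF⟩ := Finset.mem_filter.1 ha
    ext b
    constructor
    · intro hb
      obtain ⟨hb1, hb2⟩ := mem_nbrs.1 hb
      obtain ⟨hb3, hb4, -⟩ := Finset.mem_filter.1 hb1
      by_contra hbS
      exact Finset.disjoint_left.1 haF
        (Finset.mem_union_left _ (Finset.mem_sdiff.2 ⟨mem_nbrs.2 ⟨hb3, hb2⟩, hbS⟩)) hb4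
    · intro hb
      refine mem_nbrs.2 ⟨Finset.mem_filter.2 ⟨hSB a ha1 b hb, haS hb, ?_⟩,
        (mem_nbrs.1 (hS a ha1 hb)).2⟩
      exact Finset.disjoint_of_subset_left ((Finset.subset_biUnion_of_mem out hb).trans
        Finset.subset_union_right) haF
  -- Two low vertices conflict when adjacent or when they share two vertices of `B'`. A vertex has
  -- at most `D` conflicts of the first kind and, via pairs in `S a`, at most `k ^ 2 * Δ'` of the
  -- second.
  obtain ⟨A', hA', hA'c, hA'i⟩ := exists_independent_of_degree_le
    (r := fun a a' => G.Adj a a' ∨ ∃ b ∈ B', ∃ b' ∈ B', b ≠ b' ∧ G.Adj a b ∧ G.Adj a b' ∧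
      G.Adj a' b ∧ G.Adj a' b') (q := D + k ^ 2 * Δ')
    (by
      rintro a a' (h | ⟨b, hb, b', hb', h1, h2, h3, h4, h5⟩)
      · exact Or.inl h.symm
      · exact Or.inr ⟨b, hb, b', hb', h1, h4, h5, h2, h3⟩) A₂
    (by
      intro a ha
      have ha1 := hA₂A ha
      have hsub : (A₂.filter fun a' => a' ≠ a ∧ (G.Adj a a' ∨ ∃ b ∈ B', ∃ b' ∈ B', b ≠ b' ∧
          G.Adj a b ∧ G.Adj a b' ∧ G.Adj a' b ∧ G.Adj a' b')) ⊆
          G.nbrs A₀ a ∪ (S a).offDiag.biUnion fun x => G.commonNbrs A₀ {x.1, x.2} := by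
        intro a' ha'
        obtain ⟨h1, -, h2⟩ := Finset.mem_filter.1 ha'
        have h1' := hA₁ (hA₂A h1)
        rcases h2 with h2 | ⟨b, hb, b', hb', hbb, h3, h4, h5, h6⟩
        · exact Finset.mem_union_left _ (mem_nbrs.2 ⟨h1', h2⟩)
        · refine Finset.mem_union_right _ (Finset.mem_biUnion.2 ⟨(b, b'), ?_, ?_⟩)
          · rw [Finset.mem_offDiag, ← hB'S a ha]
            exact ⟨mem_nbrs.2 ⟨hb, h3⟩, mem_nbrs.2 ⟨hb', h4⟩, hbb⟩
          · simp [h1', h5, h6]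
      have h1 : (#(G.nbrs A₀ a ∪ (S a).offDiag.biUnion fun x => G.commonNbrs A₀ {x.1, x.2}) : ℝ)
          ≤ #(G.nbrs A₀ a) + ∑ x ∈ (S a).offDiag, (#(G.commonNbrs A₀ {x.1, x.2}) : ℝ) := by
        exact_mod_cast (Finset.card_union_le _ _).trans (by gcongr; exact Finset.card_biUnion_le)
      have h2 : ∑ x ∈ (S a).offDiag, (#(G.commonNbrs A₀ {x.1, x.2}) : ℝ) ≤ k ^ 2 * Δ' := by
        refine (Finset.sum_le_card_nsmul _ _ Δ' fun x hx => ?_).trans ?_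
        · obtain ⟨hx1, hx2, hx3⟩ := Finset.mem_offDiag.1 hx
          exact hpair a ha1 _ hx1 _ hx2 hx3
        · rw [nsmul_eq_mul]
          gcongr
          have : #(S a).offDiag ≤ k ^ 2 := by
            rw [Finset.offDiag_card, hSk a ha1, sq]
            omega
          exact_mod_cast this
      have h3 := hDA a (hA₁ ha1)
      refine le_trans (Nat.cast_le.2 (Finset.card_le_card (by convert hsub))) ?_
      linarith)
  have hA₁0 : (0 : ℝ) < #A₁ := by exact_mod_cast hne.card_pos
  have hA'0 : (0 : ℝ) < #A' := by
    have h1 : (0 : ℝ) < #A₁ * p ^ k := by positivity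
    by_contra! h2
    have h3 : (#A' : ℝ) = 0 := le_antisymm h2 (by positivity)
    rw [h3, mul_zero] at hA'c
    linarith
  refine ⟨A', hA'.trans hA₂A, B', Finset.filter_subset _ _, ?_, ?_, ?_, ?_, ?_, ?_⟩
  · exact Finset.card_pos.1 (by exact_mod_cast hA'0)
  -- Degrees at least `Δ` on one side and at most `D` on the other make `B₀` smaller than `A₀` by a
  -- factor `Δ / D`; `hnum` says this outweighs the losses from `A₀` to `A'`.
  · have h1 : (#B₀ : ℝ) * Δ ≤ D * #A₀ := by
      calc (#B₀ : ℝ) * Δ = #B₀ • Δ := by rw [nsmul_eq_mul]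
        _ ≤ ∑ b ∈ B₀, (#(G.nbrs A₀ b) : ℝ) := Finset.card_nsmul_le_sum _ _ _ hB₀
        _ = ∑ a ∈ A₀, (#(G.nbrs B₀ a) : ℝ) := by exact_mod_cast sum_card_nbrs_comm B₀ A₀
        _ ≤ #A₀ • D := Finset.sum_le_card_nsmul _ _ _ hDB
        _ = D * #A₀ := by rw [nsmul_eq_mul, mul_comm]
    have h2 : (#B₀ : ℝ) * (p ^ k * Δ) ≤ #A' * (p ^ k * Δ) := by
      calc (#B₀ : ℝ) * (p ^ k * Δ) = p ^ k * (#B₀ * Δ) := by ring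
        _ ≤ p ^ k * (D * (w * #A₁)) := by
            refine mul_le_mul_of_nonneg_left (h1.trans ?_) (by positivity)
            gcongr
        _ = (w * D) * (#A₁ * p ^ k) := by ring
        _ ≤ (w * D) * (2 * ((D + k ^ 2 * Δ' + 1) * #A')) := by
            refine mul_le_mul_of_nonneg_left (hA₂c.trans ?_) (by positivity)
            gcongr
        _ = 2 * (w * D) * (D + k ^ 2 * Δ' + 1) * #A' := by ring
        _ ≤ p ^ k * Δ * #A' := by gcongr
        _ = _ := by ring
    have h3 : (#B₀ : ℝ) ≤ #A' := le_of_mul_le_mul_right h2 (by positivity)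
    exact (Finset.card_le_card (Finset.filter_subset _ _)).trans (by exact_mod_cast h3)
  · intro a ha a' ha' h
    exact hA'i a ha a' ha' h.ne (Or.inl h)
  · intro b hb b' hb' h
    obtain ⟨h1, h2, h3⟩ := Finset.mem_filter.1 hb
    obtain ⟨h1', h2', h3'⟩ := Finset.mem_filter.1 hb'
    rcases horient b h1 b' h1' h with h4 | h4
    · exact Finset.disjoint_left.1 h3 h4 h2'
    · exact Finset.disjoint_left.1 h3' h4 h2
  · intro a ha
    rw [hB'S a (hA' ha), hSk a (hA₂A (hA' ha))]
  · intro a ha a' ha' hne b hb b' hb' h1 h2 h3 h4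
    by_contra hbb
    exact hA'i a ha a' ha' hne (Or.inr ⟨b, hb, b', hb', hbb, h1, h2, h3, h4⟩)

end Extract

/-! ### Orientations, vertex deletion and moment bounds -/

section Degenerate

variable {V : Type*} {G : SimpleGraph V}

/-- A graph all of whose induced subgraphs have average degree at most `d` has an
orientation with out-degrees at most `d`. -/
lemma exists_orientation {d : ℝ} (X : Finset V)
    (h : ∀ Y ⊆ X, ∑ v ∈ Y, (#(G.nbrs Y v) : ℝ) ≤ d * #Y) :
    ∃ out : V → Finset V, (∀ v ∈ X, (#(out v) : ℝ) ≤ d) ∧ (∀ v ∈ X, ∀ w ∈ out v, G.Adj v w) ∧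
      ∀ v ∈ X, ∀ w ∈ X, G.Adj v w → w ∈ out v ∨ v ∈ out w := by
  induction X using Finset.strongInduction with
  | H X ih =>
    rcases X.eq_empty_or_nonempty with rfl | hne
    · exact ⟨fun _ => ∅, by simp, by simp, by simp⟩
    -- Degeneracy: peel off a vertex of at most average degree and orient all its remaining edges
    -- outwards.
    obtain ⟨v, hv, hvd⟩ : ∃ v ∈ X, (#(G.nbrs X v) : ℝ) ≤ d := by
      by_contra! hcon
      have h1 := Finset.sum_lt_sum_of_nonempty hne hcon
      have h2 := h X subset_rfl
      rw [Finset.sum_const, nsmul_eq_mul] at h1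
      linarith
    obtain ⟨out, h1, h2, h3⟩ := ih (X.erase v) (Finset.erase_ssubset hv)
      fun Y hY => h Y (hY.trans (Finset.erase_subset _ _))
    have hmem : ∀ w ∈ X, w ≠ v → w ∈ X.erase v := fun w hw hwv => Finset.mem_erase.2 ⟨hwv, hw⟩
    refine ⟨Function.update out v (G.nbrs X v), fun w hw => ?_, fun w hw u hu => ?_,
      fun w hw u hu hwu => ?_⟩
    · by_cases hwv : w = v
      · subst hwv
        simpa using hvd
      · simpa [hwv] using h1 w (hmem w hw hwv)
    · by_cases hwv : w = v
      · subst hwv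
        simp only [Function.update_self, mem_nbrs] at hu
        exact hu.2
      · rw [Function.update_of_ne hwv] at hu
        exact h2 w (hmem w hw hwv) u hu
    · by_cases hwv : w = v
      · subst hwv
        left
        simp [hu, hwu]
      · by_cases huv : u = v
        · subst huv
          right
          simp [hw, hwu.symm]
        · simpa [hwv, huv] using h3 w (hmem w hw hwv) u (hmem u hu huv) hwu

/-- Each lost edge has an end in `R` and contributes `2` to the degree sum. -/
lemma sum_card_nbrs_sdiff (S R : Finset V) :
    (∑ v ∈ S, (#(G.nbrs S v) : ℝ)) - 2 * ∑ v ∈ R ∩ S, (#(G.nbrs S v) : ℝ)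
      ≤ ∑ v ∈ S \ R, (#(G.nbrs (S \ R) v) : ℝ) := by
  have h1 : ∀ v, (#(G.nbrs S v) : ℝ) ≤ #(G.nbrs (S \ R) v) + #(G.nbrs (R ∩ S) v) := by
    intro v
    have : G.nbrs S v ⊆ G.nbrs (S \ R) v ∪ G.nbrs (R ∩ S) v := by
      intro w hw
      simp only [Finset.mem_union, mem_nbrs, Finset.mem_sdiff, Finset.mem_inter] at hw ⊢
      tauto
    exact_mod_cast (Finset.card_le_card this).trans (Finset.card_union_le _ _)
  have h2 : ∑ v ∈ S, (#(G.nbrs S v) : ℝ)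
      = ∑ v ∈ S \ R, (#(G.nbrs S v) : ℝ) + ∑ v ∈ R ∩ S, (#(G.nbrs S v) : ℝ) := by
    rw [Finset.inter_comm, add_comm, Finset.sum_inter_add_sum_sdiff]
  have h3 : ∑ v ∈ S \ R, (#(G.nbrs S v) : ℝ)
      ≤ ∑ v ∈ S \ R, (#(G.nbrs (S \ R) v) : ℝ) + ∑ v ∈ S \ R, (#(G.nbrs (R ∩ S) v) : ℝ) := by
    rw [← Finset.sum_add_distrib]
    exact Finset.sum_le_sum fun v _ => h1 v
  have h4 : ∑ v ∈ S \ R, (#(G.nbrs (R ∩ S) v) : ℝ) = ∑ v ∈ R ∩ S, (#(G.nbrs (S \ R) v) : ℝ) := by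
    exact_mod_cast sum_card_nbrs_comm (S \ R) (R ∩ S)
  have h5 : ∑ v ∈ R ∩ S, (#(G.nbrs (S \ R) v) : ℝ) ≤ ∑ v ∈ R ∩ S, (#(G.nbrs S v) : ℝ) :=
    Finset.sum_le_sum fun v _ => card_nbrs_mono Finset.sdiff_subset v
  linarith

/-- Markov-type bound: the vertices of large degree carry few edges. -/
lemma sum_large_le {ι : Type*} (S : Finset ι) (f : ι → ℝ) {K : ℝ} (hK : 0 < K)
    (hf : ∀ i ∈ S, 0 ≤ f i) :
    ∑ i ∈ S.filter (fun i => K < f i), f i ≤ (1 / K) * ∑ i ∈ S, f i ^ 2 := by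
  rw [Finset.mul_sum]
  refine (Finset.sum_le_sum fun i hi => ?_).trans
    (Finset.sum_le_sum_of_subset_of_nonneg (Finset.filter_subset _ S) fun i _ _ => by positivity)
  obtain ⟨hi1, hi2⟩ := Finset.mem_filter.1 hi
  rw [one_div, inv_mul_eq_div, le_div_iff₀ hK, sq]
  exact mul_le_mul_of_nonneg_left hi2.le (hf i hi1)

/-- Second moment of a sampled degree: `c u w` is the number of vertices that must be sampled for
the ordered pair `(u, w)` to count, one fewer on the diagonal. -/
lemma sum_pow_card_pair_le {p : ℝ} (hp : 0 ≤ p) (m : ℕ) (X : Finset V) {L : ℝ} (hX : #X ≤ L)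
    (c : V → V → ℕ) (hc : ∀ u ∈ X, c u u = m) (hc' : ∀ u ∈ X, ∀ w ∈ X, u ≠ w → c u w = m + 1) :
    ∑ x ∈ X ×ˢ X, p ^ c x.1 x.2 ≤ #X * (p ^ m + L * p ^ (m + 1)) := by
  rw [Finset.sum_product, ← nsmul_eq_mul]
  refine Finset.sum_le_card_nsmul _ _ _ fun u hu => ?_
  rw [← Finset.add_sum_erase _ _ hu]
  refine add_le_add (by rw [hc u hu]) ?_
  rw [Finset.sum_congr rfl fun w hw => by
    rw [hc' u hu w (Finset.mem_of_mem_erase hw) (Finset.ne_of_mem_erase hw).symm],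
    Finset.sum_const, nsmul_eq_mul]
  gcongr
  exact le_trans (by exact_mod_cast Finset.card_le_card (Finset.erase_subset _ _)) hX

end Degenerate

/-! ### Random sparsification and balancing -/

section Sparsify

variable {V : Type*} [Fintype V] {G : SimpleGraph V}

set_option maxHeartbeats 400000 in
/-- A sparse random induced subgraph of a graph with few 3- and 4-cycles, cleaned up. -/
lemma exists_C3C4_sparse {X : Finset V} {Δ d p Z : ℝ} (hne : X.Nonempty)
    (hX : ∀ v ∈ X, (#(G.nbrs X v) : ℝ) ≤ Δ) (hd : d * #X ≤ ∑ v ∈ X, (#(G.nbrs X v) : ℝ))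
    (hZ : ∀ Y Y' : Finset V, (#Y : ℝ) ≤ Δ → (#Y' : ℝ) ≤ Δ → ∑ y ∈ Y, (#(G.nbrs Y' y) : ℝ) ≤ Z)
    (hp0 : 0 < p) (hp1 : p ≤ 1) (hpΔ : 1 ≤ p * Δ) (hpd : 1 ≤ p * d)
    (hpZ : 256 * (p ^ 3 * Δ * Z) ≤ 1) :
    ∃ S ⊆ X, S.Nonempty ∧ p * d / 8 * #S ≤ ∑ v ∈ S, (#(G.nbrs S v) : ℝ) ∧
      (∀ v ∈ S, (#(G.nbrs S v) : ℝ) ≤ 16 * (p * Δ)) ∧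
      (∀ u ∈ S, ∀ v ∈ S, ∀ w ∈ S, G.Adj u v → G.Adj u w → ¬ G.Adj v w) ∧
      (∀ a ∈ S, ∀ b ∈ S, ∀ x ∈ S, ∀ y ∈ S, a ≠ x → b ≠ y → G.Adj a b → G.Adj b x → G.Adj x y →
        ¬ G.Adj a y) := by
  set K : ℝ := 16 * (p * Δ) with hK
  have hK0 : 0 < K := by linarith
  have hX0 : (0 : ℝ) < #X := by exact_mod_cast hne.card_pos
  have hd0 : 0 < d := by
    by_contra! h
    have : p * d ≤ 0 := mul_nonpos_of_nonneg_of_nonpos hp0.le h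
    linarith
  set e : ℝ := ∑ v ∈ X, (#(G.nbrs X v) : ℝ) with he
  have he0 : 0 < e := lt_of_lt_of_le (by positivity) hd
  set J₁ : Finset (Σ _ : V, V) := X.sigma fun v => G.nbrs X v with hJ₁
  set J₂ : Finset (Σ _ : V, V × V) := X.sigma fun v => G.nbrs X v ×ˢ G.nbrs X v with hJ₂
  set J₃ : Finset (Σ _ : V, Σ _ : V, V) :=
    X.sigma fun v => (G.nbrs X v).sigma fun u => G.nbrs (G.nbrs X v) u with hJ₃
  -- Rooted 4-cycles `a b x y`; the two erasures exclude `x = a` and `y = b`, so the four vertices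
  -- are distinct.
  set J₄ : Finset (Σ _ : V, Σ _ : V, Σ _ : V, V) :=
    X.sigma fun a => (G.nbrs X a).sigma fun b => ((G.nbrs X b).erase a).sigma fun x =>
      (G.nbrs (G.nbrs X a) x).erase b with hJ₄
  set T₃ : (Σ _ : V, Σ _ : V, V) → Finset V := fun j => {j.1, j.2.1, j.2.2} with hT₃
  set T₄ : (Σ _ : V, Σ _ : V, Σ _ : V, V) → Finset V :=
    fun j => {j.1, j.2.1, j.2.2.1, j.2.2.2} with hT₄
  clear_value e K J₁ J₂ J₃ J₄
  -- The degree sum minus the cost of the cleaning. The `2 / K` term bounds the loss from deleting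
  -- vertices of degree above `K`; afterwards each short cycle costs at most `2K`, by deleting its
  -- root. The last term is the required average degree.
  obtain ⟨S, hS⟩ := exists_expectation_le hp0.le hp1 fun S : Finset V =>
    (#(J₁.filter fun j => ({j.1, j.2} : Finset V) ⊆ S) : ℝ)
      - (2 / K) * #(J₂.filter fun j => ({j.1, j.2.1, j.2.2} : Finset V) ⊆ S)
      - (2 * K) * #(J₃.filter fun j => T₃ j ⊆ S)
      - (2 * K) * #(J₄.filter fun j => T₄ j ⊆ S)
      - (p * d / 8) * #(X.filter fun v => ({v} : Finset V) ⊆ S)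
  simp only [expectation_sub, expectation_const_mul, expectation_card_filter] at hS
  have hE₁ : ∑ j ∈ J₁, p ^ #({j.1, j.2} : Finset V) = e * p ^ 2 := by
    rw [hJ₁, Finset.sum_sigma, he, Finset.sum_mul]
    refine Finset.sum_congr rfl fun v _ => ?_
    rw [Finset.sum_congr rfl fun u hu => by rw [Finset.card_pair (mem_nbrs.1 hu).2.ne],
      Finset.sum_const, nsmul_eq_mul]
  have hE₂ : ∑ j ∈ J₂, p ^ #({j.1, j.2.1, j.2.2} : Finset V) ≤ e * (p ^ 2 + Δ * p ^ 3) := by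
    rw [hJ₂, Finset.sum_sigma, he, Finset.sum_mul]
    refine Finset.sum_le_sum fun v hv => ?_
    refine sum_pow_card_pair_le hp0.le 2 (G.nbrs X v) (hX v hv) (fun u w => #({v, u, w} : Finset V))
      (fun u hu => ?_) (fun u hu w hw huw => ?_)
    · simp [Finset.card_pair (mem_nbrs.1 hu).2.ne]
    · exact Finset.card_eq_three.2 ⟨v, u, w, (mem_nbrs.1 hu).2.ne, (mem_nbrs.1 hw).2.ne, huw, rfl⟩
  have hE₃ : ∑ j ∈ J₃, p ^ #(T₃ j) ≤ #X * (Z * p ^ 3) := by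
    rw [hJ₃, Finset.sum_sigma, ← nsmul_eq_mul]
    refine Finset.sum_le_card_nsmul _ _ _ fun v hv => ?_
    rw [Finset.sum_sigma]
    refine le_trans ?_ (mul_le_mul_of_nonneg_right (hZ _ _ (hX v hv) (hX v hv)) (by positivity))
    rw [Finset.sum_mul]
    refine Finset.sum_le_sum fun u hu => ?_
    rw [← nsmul_eq_mul]
    refine Finset.sum_le_card_nsmul _ _ _ fun w hw => le_of_eq ?_
    congr 1
    simp only [mem_nbrs] at hu hw
    exact Finset.card_eq_three.2 ⟨v, u, w, hu.2.ne, hw.1.2.ne, hw.2.ne, rfl⟩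
  have hE₄ : ∑ j ∈ J₄, p ^ #(T₄ j) ≤ e * (Z * p ^ 4) := by
    rw [hJ₄, Finset.sum_sigma, he, Finset.sum_mul]
    refine Finset.sum_le_sum fun a ha => ?_
    rw [Finset.sum_sigma, ← nsmul_eq_mul]
    refine Finset.sum_le_card_nsmul _ _ _ fun b hb => ?_
    obtain ⟨hbX, hab⟩ := mem_nbrs.1 hb
    rw [Finset.sum_sigma]
    refine le_trans ?_ (mul_le_mul_of_nonneg_right (hZ _ _ (hX b hbX) (hX a ha)) (by positivity))
    rw [Finset.sum_mul]
    refine (Finset.sum_le_sum fun x hx => ?_).trans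
      (Finset.sum_le_sum_of_subset_of_nonneg (Finset.erase_subset a _)
        fun _ _ _ => by positivity)
    have h1 : (#((G.nbrs (G.nbrs X a) x).erase b) : ℝ) ≤ #(G.nbrs (G.nbrs X a) x) := by
      exact_mod_cast Finset.card_le_card (Finset.erase_subset _ _)
    refine le_trans ?_ (mul_le_mul_of_nonneg_right h1 (by positivity))
    rw [← nsmul_eq_mul]
    refine Finset.sum_le_card_nsmul _ _ _ fun y hy => le_of_eq ?_
    congr 1
    simp only [mem_nbrs, Finset.mem_erase] at hx hy
    simp only [hT₄]
    rw [Finset.card_insert_of_notMem, Finset.card_eq_three.2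
      ⟨b, x, y, hx.2.2.ne, hy.1.symm, hy.2.2.ne, rfl⟩]
    simp only [Finset.mem_insert, Finset.mem_singleton, not_or]
    exact ⟨hab.ne, hx.1.symm, hy.2.1.2.ne⟩
  have hE₅ : ∑ v ∈ X, p ^ #({v} : Finset V) = #X * p := by simp
  -- The four losses are at most `1/4`, `1/8`, `1/8` and `1/8` of the main term `e * p ^ 2`.
  rw [hE₁, hE₅] at hS
  have hpos : 0 < e * p ^ 2
      - (2 / K) * ∑ j ∈ J₂, p ^ #({j.1, j.2.1, j.2.2} : Finset V)
      - (2 * K) * ∑ j ∈ J₃, p ^ #(T₃ j) - (2 * K) * ∑ j ∈ J₄, p ^ #(T₄ j)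
      - (p * d / 8) * (#X * p) := by
    have h2 : (2 / K) * ∑ j ∈ J₂, p ^ #({j.1, j.2.1, j.2.2} : Finset V) ≤ e * p ^ 2 / 4 := by
      refine (mul_le_mul_of_nonneg_left hE₂ (by positivity)).trans ?_
      rw [div_mul_eq_mul_div, div_le_iff₀ hK0, hK]
      have : p ^ 2 + Δ * p ^ 3 ≤ p ^ 2 * (2 * (p * Δ)) := by
        have : 0 ≤ p ^ 2 * (p * Δ - 1) := mul_nonneg (by positivity) (by linarith)
        nlinarith
      calc 2 * (e * (p ^ 2 + Δ * p ^ 3)) ≤ 2 * (e * (p ^ 2 * (2 * (p * Δ)))) := by gcongr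
        _ = e * p ^ 2 / 4 * (16 * (p * Δ)) := by ring
    have h3 : (2 * K) * ∑ j ∈ J₃, p ^ #(T₃ j) ≤ e * p ^ 2 / 8 := by
      refine (mul_le_mul_of_nonneg_left hE₃ (by positivity)).trans ?_
      calc 2 * K * (#X * (Z * p ^ 3)) = #X * p / 8 * (256 * (p ^ 3 * Δ * Z)) := by rw [hK]; ring
        _ ≤ #X * p / 8 * (p * d) := by
            refine mul_le_mul_of_nonneg_left (by linarith) (by positivity)
        _ = (d * #X) * p ^ 2 / 8 := by ring
        _ ≤ e * p ^ 2 / 8 := by gcongr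
    have h4 : (2 * K) * ∑ j ∈ J₄, p ^ #(T₄ j) ≤ e * p ^ 2 / 8 := by
      refine (mul_le_mul_of_nonneg_left hE₄ (by positivity)).trans ?_
      calc 2 * K * (e * (Z * p ^ 4)) = e * p ^ 2 / 8 * (256 * (p ^ 3 * Δ * Z)) := by rw [hK]; ring
        _ ≤ e * p ^ 2 / 8 * 1 := by gcongr
        _ = e * p ^ 2 / 8 := by ring
    have h5 : (p * d / 8) * (#X * p) ≤ e * p ^ 2 / 8 := by
      calc (p * d / 8) * (#X * p) = (d * #X) * p ^ 2 / 8 := by ring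
        _ ≤ e * p ^ 2 / 8 := by gcongr
    have h6 : 0 < e * p ^ 2 := by positivity
    linarith
  replace hS := hpos.trans_le hS
  set S₀ := X.filter fun v => v ∈ S with hS₀
  have hmS₀ : ∀ v, v ∈ S₀ ↔ v ∈ X ∧ v ∈ S := fun v => by simp [hS₀]
  have hF₁ : (#(J₁.filter fun j => ({j.1, j.2} : Finset V) ⊆ S) : ℝ)
      = ∑ v ∈ S₀, (#(G.nbrs S₀ v) : ℝ) := by
    have : J₁.filter (fun j => ({j.1, j.2} : Finset V) ⊆ S) = S₀.sigma fun v => G.nbrs S₀ v := by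
      ext ⟨v, u⟩
      simp only [hJ₁, Finset.mem_filter, Finset.mem_sigma, mem_nbrs, hmS₀, Finset.insert_subset_iff,
        Finset.singleton_subset_iff]
      tauto
    rw [this, Finset.card_sigma]
    push_cast
    rfl
  have hF₂ : (#(J₂.filter fun j => ({j.1, j.2.1, j.2.2} : Finset V) ⊆ S) : ℝ)
      = ∑ v ∈ S₀, (#(G.nbrs S₀ v) : ℝ) ^ 2 := by
    have : J₂.filter (fun j => ({j.1, j.2.1, j.2.2} : Finset V) ⊆ S)
        = S₀.sigma fun v => G.nbrs S₀ v ×ˢ G.nbrs S₀ v := by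
      ext ⟨v, u, w⟩
      simp only [hJ₂, Finset.mem_filter, Finset.mem_sigma, Finset.mem_product, mem_nbrs, hmS₀,
        Finset.insert_subset_iff, Finset.singleton_subset_iff]
      tauto
    rw [this, Finset.card_sigma]
    push_cast
    exact Finset.sum_congr rfl fun v _ => by rw [Finset.card_product]; push_cast; ring
  have hF₅ : X.filter (fun v => ({v} : Finset V) ⊆ S) = S₀ := by
    ext v
    simp [hmS₀]
  rw [hF₁, hF₂, hF₅] at hS
  set R₁ := S₀.filter fun v => K < #(G.nbrs S₀ v) with hR₁
  set S₁ := S₀ \ R₁ with hS₁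
  have hS₁S₀ : S₁ ⊆ S₀ := Finset.sdiff_subset
  have hS₁K : ∀ v ∈ S₁, (#(G.nbrs S₁ v) : ℝ) ≤ K := by
    intro v hv
    obtain ⟨h1, h2⟩ := Finset.mem_sdiff.1 hv
    refine (card_nbrs_mono hS₁S₀ v).trans ?_
    by_contra! h3
    exact h2 (Finset.mem_filter.2 ⟨h1, h3⟩)
  have hL₁ := sum_card_nbrs_sdiff (G := G) S₀ R₁
  rw [Finset.inter_eq_left.2 (Finset.filter_subset _ _)] at hL₁
  have hL₁' : ∑ v ∈ R₁, (#(G.nbrs S₀ v) : ℝ) ≤ (1 / K) * ∑ v ∈ S₀, (#(G.nbrs S₀ v) : ℝ) ^ 2 :=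
    sum_large_le S₀ _ hK0 fun _ _ => by positivity
  set R₂ := (J₃.filter fun j => T₃ j ⊆ S₁).image Sigma.fst ∪
    (J₄.filter fun j => T₄ j ⊆ S₁).image Sigma.fst with hR₂
  have hS₁S : S₁ ⊆ S := fun v hv => ((hmS₀ v).1 (hS₁S₀ hv)).2
  have hS₁X : S₁ ⊆ X := fun v hv => ((hmS₀ v).1 (hS₁S₀ hv)).1
  have hR₂c : (#R₂ : ℝ) ≤ #(J₃.filter fun j => T₃ j ⊆ S) + #(J₄.filter fun j => T₄ j ⊆ S) := by
    have h1 : #R₂ ≤ #(J₃.filter fun j => T₃ j ⊆ S) + #(J₄.filter fun j => T₄ j ⊆ S) := by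
      refine (Finset.card_union_le _ _).trans (add_le_add ?_ ?_) <;>
      · refine Finset.card_image_le.trans (Finset.card_le_card ?_)
        exact Finset.monotone_filter_right _ fun j _ hj => hj.trans hS₁S
    exact_mod_cast h1
  have hL₂ := sum_card_nbrs_sdiff (G := G) S₁ R₂
  have hL₂' : ∑ v ∈ R₂ ∩ S₁, (#(G.nbrs S₁ v) : ℝ) ≤ #R₂ * K := by
    refine (Finset.sum_le_card_nsmul _ _ K fun v hv => hS₁K v (Finset.mem_inter.1 hv).2).trans ?_
    rw [nsmul_eq_mul]
    gcongr
    exact Finset.inter_subset_left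
  set S₂ := S₁ \ R₂ with hS₂
  have hS₂S₁ : S₂ ⊆ S₁ := Finset.sdiff_subset
  have hR₂K : (#R₂ : ℝ) * K ≤
      (#(J₃.filter fun j => T₃ j ⊆ S) + #(J₄.filter fun j => T₄ j ⊆ S)) * K := by gcongr
  have hfin : p * d / 8 * #S₀ < ∑ v ∈ S₂, (#(G.nbrs S₂ v) : ℝ) := by
    have : (2 / K) * ∑ v ∈ S₀, (#(G.nbrs S₀ v) : ℝ) ^ 2
        = 2 * ((1 / K) * ∑ v ∈ S₀, (#(G.nbrs S₀ v) : ℝ) ^ 2) := by ring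
    rw [this] at hS
    linarith
  refine ⟨S₂, hS₂S₁.trans hS₁X, ?_, ?_, ?_, ?_, ?_⟩
  · by_contra h
    rw [Finset.not_nonempty_iff_eq_empty.1 h, Finset.sum_empty] at hfin
    have : 0 ≤ p * d / 8 * (#S₀ : ℝ) := by positivity
    linarith
  · refine le_trans ?_ hfin.le
    gcongr
    exact hS₂S₁.trans hS₁S₀
  · exact fun v hv => (card_nbrs_mono hS₂S₁ v).trans (hS₁K v (hS₂S₁ hv))
  · intro u hu v hv w hw huv huw hvw
    refine (Finset.mem_sdiff.1 hu).2 (Finset.mem_union_left _ (Finset.mem_image.2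
      ⟨⟨u, v, w⟩, Finset.mem_filter.2 ⟨?_, ?_⟩, rfl⟩))
    · simp only [hJ₃, Finset.mem_sigma, mem_nbrs]
      exact ⟨hS₁X (hS₂S₁ hu), ⟨hS₁X (hS₂S₁ hv), huv⟩, ⟨hS₁X (hS₂S₁ hw), huw⟩, hvw⟩
    · simp only [hT₃, Finset.insert_subset_iff, Finset.singleton_subset_iff]
      exact ⟨hS₂S₁ hu, hS₂S₁ hv, hS₂S₁ hw⟩
  · intro a ha b hb x hx y hy hax hby hab hbx hxy hay
    refine (Finset.mem_sdiff.1 ha).2 (Finset.mem_union_right _ (Finset.mem_image.2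
      ⟨⟨a, b, x, y⟩, Finset.mem_filter.2 ⟨?_, ?_⟩, rfl⟩))
    · simp only [hJ₄, Finset.mem_sigma, mem_nbrs, Finset.mem_erase]
      exact ⟨hS₁X (hS₂S₁ ha), ⟨hS₁X (hS₂S₁ hb), hab⟩, ⟨hax.symm, hS₁X (hS₂S₁ hx), hbx⟩,
        hby.symm, ⟨hS₁X (hS₂S₁ hy), hay⟩, hxy⟩
    · simp only [hT₄, Finset.insert_subset_iff, Finset.singleton_subset_iff]
      exact ⟨hS₂S₁ ha, hS₂S₁ hb, hS₂S₁ hx, hS₂S₁ hy⟩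

/-- Sampling the larger side of an unbalanced bipartite graph makes it balanced. -/
lemma exists_balanced {A B : Finset V} {p d n D L : ℝ} (hp0 : 0 < p) (hp1 : p ≤ 1) (hn : 0 < n)
    (hd : 0 < d) (hA : #A ≤ n) (hB : #B ≤ n * p) (hL : ∀ b ∈ B, (#(G.nbrs A b) : ℝ) ≤ L)
    (hL0 : 0 ≤ L) (hD : 4 * (1 + p * L) ≤ D) (he : n * d ≤ ∑ b ∈ B, (#(G.nbrs A b) : ℝ)) :
    ∃ S ⊆ A, ∃ B' ⊆ B, (∀ b ∈ B', (#(G.nbrs S b) : ℝ) ≤ D) ∧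
      d / 4 * (#S + #B') < ∑ b ∈ B', (#(G.nbrs S b) : ℝ) := by
  have hD0 : 0 < D := lt_of_lt_of_le (by positivity) hD
  set e : ℝ := ∑ b ∈ B, (#(G.nbrs A b) : ℝ) with hedef
  set J₁ : Finset (Σ _ : V, V) := B.sigma fun v => G.nbrs A v with hJ₁
  set J₂ : Finset (Σ _ : V, V × V) := B.sigma fun v => G.nbrs A v ×ˢ G.nbrs A v with hJ₂
  clear_value e J₁ J₂
  have he0 : 0 < e := lt_of_lt_of_le (by positivity) he
  -- The `1 / D` term pays for discarding vertices of `B` of sampled degree above `D`. Each of the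
  -- three losses is at most a quarter of `e * p` in expectation.
  obtain ⟨S, hS⟩ := exists_expectation_le hp0.le hp1 fun S : Finset V =>
    (#(J₁.filter fun j => ({j.2} : Finset V) ⊆ S) : ℝ)
      - (1 / D) * #(J₂.filter fun j => ({j.2.1, j.2.2} : Finset V) ⊆ S)
      - (d / 4) * #(A.filter fun v => ({v} : Finset V) ⊆ S) - d / 4 * #B
  simp only [expectation_sub, expectation_const_mul, expectation_card_filter,
    expectation_const] at hS
  have hE₁ : ∑ j ∈ J₁, p ^ #({j.2} : Finset V) = e * p := by
    rw [hJ₁, Finset.sum_sigma, hedef, Finset.sum_mul]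
    exact Finset.sum_congr rfl fun v _ => by simp
  have hE₂ : ∑ j ∈ J₂, p ^ #({j.2.1, j.2.2} : Finset V) ≤ e * (p + L * p ^ 2) := by
    rw [hJ₂, Finset.sum_sigma, hedef, Finset.sum_mul]
    refine Finset.sum_le_sum fun v hv => ?_
    have := sum_pow_card_pair_le hp0.le 1 (G.nbrs A v) (hL v hv) (fun u w => #({u, w} : Finset V))
      (fun u hu => by simp) (fun u hu w hw huw => Finset.card_pair huw)
    simpa using this
  have hE₃ : ∑ v ∈ A, p ^ #({v} : Finset V) = #A * p := by simp
  rw [hE₁, hE₃] at hS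
  have hpos : 0 < e * p - (1 / D) * ∑ j ∈ J₂, p ^ #({j.2.1, j.2.2} : Finset V)
      - (d / 4) * (#A * p) - d / 4 * #B := by
    have h1 : (1 / D) * ∑ j ∈ J₂, p ^ #({j.2.1, j.2.2} : Finset V) ≤ e * p / 4 := by
      refine (mul_le_mul_of_nonneg_left hE₂ (by positivity)).trans ?_
      rw [div_mul_eq_mul_div, div_le_iff₀ hD0]
      calc 1 * (e * (p + L * p ^ 2)) = e * p / 4 * (4 * (1 + p * L)) := by ring
        _ ≤ e * p / 4 * D := by gcongr
    have h2 : (d / 4) * (#A * p) ≤ d / 4 * (n * p) := by gcongr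
    have h3 : d / 4 * #B ≤ d / 4 * (n * p) := by gcongr
    have h4 : n * d * p ≤ e * p := by gcongr
    have h5 : 0 < n * d * p := by positivity
    nlinarith
  replace hS := hpos.trans_le hS
  set S₀ := A.filter fun v => v ∈ S with hS₀
  have hmS₀ : ∀ v, v ∈ S₀ ↔ v ∈ A ∧ v ∈ S := fun v => by simp [hS₀]
  have hF₁ : (#(J₁.filter fun j => ({j.2} : Finset V) ⊆ S) : ℝ)
      = ∑ v ∈ B, (#(G.nbrs S₀ v) : ℝ) := by
    have : J₁.filter (fun j => ({j.2} : Finset V) ⊆ S) = B.sigma fun v => G.nbrs S₀ v := by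
      ext ⟨v, u⟩
      simp only [hJ₁, Finset.mem_filter, Finset.mem_sigma, mem_nbrs, hmS₀,
        Finset.singleton_subset_iff]
      tauto
    rw [this, Finset.card_sigma]
    push_cast
    rfl
  have hF₂ : (#(J₂.filter fun j => ({j.2.1, j.2.2} : Finset V) ⊆ S) : ℝ)
      = ∑ v ∈ B, (#(G.nbrs S₀ v) : ℝ) ^ 2 := by
    have : J₂.filter (fun j => ({j.2.1, j.2.2} : Finset V) ⊆ S)
        = B.sigma fun v => G.nbrs S₀ v ×ˢ G.nbrs S₀ v := by
      ext ⟨v, u, w⟩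
      simp only [hJ₂, Finset.mem_filter, Finset.mem_sigma, Finset.mem_product, mem_nbrs, hmS₀,
        Finset.insert_subset_iff, Finset.singleton_subset_iff]
      tauto
    rw [this, Finset.card_sigma]
    push_cast
    exact Finset.sum_congr rfl fun v _ => by rw [Finset.card_product]; push_cast; ring
  have hF₃ : A.filter (fun v => ({v} : Finset V) ⊆ S) = S₀ := by
    ext v
    simp [hmS₀]
  rw [hF₁, hF₂, hF₃] at hS
  have hlarge := sum_large_le B (fun v => (#(G.nbrs S₀ v) : ℝ)) hD0 fun _ _ => by positivity
  have hsplit := Finset.sum_filter_add_sum_filter_not B (fun v => D < (#(G.nbrs S₀ v) : ℝ))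
    fun v => (#(G.nbrs S₀ v) : ℝ)
  refine ⟨S₀, Finset.filter_subset _ _, B.filter fun v => ¬ D < (#(G.nbrs S₀ v) : ℝ),
    Finset.filter_subset _ _, fun b hb => not_lt.1 (Finset.mem_filter.1 hb).2, ?_⟩
  have hBc : d / 4 * (#(B.filter fun v => ¬ D < (#(G.nbrs S₀ v) : ℝ)) : ℝ) ≤ d / 4 * #B := by
    gcongr
    exact Finset.filter_subset _ _
  linarith

end Sparsify

/-! ### Almost regular subgraphs or very unbalanced edges -/

section Dichotomy

variable {V : Type*} {G : SimpleGraph V}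

variable (G) in
/-- The vertices of `X` of degree at most `D` in `X`. -/
noncomputable def lowDeg (X : Finset V) (D : ℝ) : Finset V :=
  X.filter fun v => (#(G.nbrs X v) : ℝ) ≤ D

variable (G) in
/-- The vertices of `X` of degree more than `D` in `X`. -/
noncomputable def highDeg (X : Finset V) (D : ℝ) : Finset V :=
  X.filter fun v => D < (#(G.nbrs X v) : ℝ)

lemma mem_lowDeg {X : Finset V} {D : ℝ} {v : V} :
    v ∈ G.lowDeg X D ↔ v ∈ X ∧ (#(G.nbrs X v) : ℝ) ≤ D := by
  simp [lowDeg]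

lemma mem_highDeg {X : Finset V} {D : ℝ} {v : V} :
    v ∈ G.highDeg X D ↔ v ∈ X ∧ D < (#(G.nbrs X v) : ℝ) := by
  simp [highDeg]

lemma card_nbrs_union_le (A B : Finset V) (v : V) :
    (#(G.nbrs (A ∪ B) v) : ℝ) ≤ #(G.nbrs A v) + #(G.nbrs B v) := by
  have : G.nbrs (A ∪ B) v ⊆ G.nbrs A v ∪ G.nbrs B v := by
    intro w hw
    simp only [Finset.mem_union, mem_nbrs] at hw ⊢
    tauto
  exact_mod_cast (Finset.card_le_card this).trans (Finset.card_union_le _ _)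

lemma card_mul_le_sum_of_forall {ι : Type*} {S T : Finset ι} (hST : S ⊆ T) {f : ι → ℝ} {c : ℝ}
    (hf : ∀ i ∈ T, 0 ≤ f i) (hc : ∀ i ∈ S, c ≤ f i) : #S * c ≤ ∑ i ∈ T, f i := by
  rw [← nsmul_eq_mul]
  exact (Finset.card_nsmul_le_sum _ _ _ hc).trans
    (Finset.sum_le_sum_of_subset_of_nonneg hST fun i hi _ => hf i hi)

lemma sum_le_card_mul {ι : Type*} {S : Finset ι} {f : ι → ℝ} {c : ℝ}
    (hc : ∀ i ∈ S, f i ≤ c) : ∑ i ∈ S, f i ≤ #S * c := by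
  rw [← nsmul_eq_mul]
  exact Finset.sum_le_card_nsmul _ _ _ hc

lemma sum_card_nbrs_union_ge {S B : Finset V} (h : Disjoint S B) :
    2 * ∑ b ∈ B, (#(G.nbrs S b) : ℝ) ≤ ∑ v ∈ S ∪ B, (#(G.nbrs (S ∪ B) v) : ℝ) := by
  rw [Finset.sum_union h]
  have h1 : ∑ b ∈ B, (#(G.nbrs S b) : ℝ) = ∑ v ∈ S, (#(G.nbrs B v) : ℝ) := by
    exact_mod_cast sum_card_nbrs_comm B S
  have h2 : ∑ v ∈ S, (#(G.nbrs B v) : ℝ) ≤ ∑ v ∈ S, (#(G.nbrs (S ∪ B) v) : ℝ) :=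
    Finset.sum_le_sum fun v _ => card_nbrs_mono Finset.subset_union_right v
  have h3 : ∑ v ∈ B, (#(G.nbrs S v) : ℝ) ≤ ∑ v ∈ B, (#(G.nbrs (S ∪ B) v) : ℝ) :=
    Finset.sum_le_sum fun v _ => card_nbrs_mono Finset.subset_union_left v
  linarith

/-- Some dyadic range of degrees carries a `1 / (2 Q)` proportion of the edges. -/
lemma exists_dyadic_class {X A B : Finset V} {d Q W : ℝ} (hQ : 1 ≤ Q) (hd : 0 < d)
    (hB : ∀ b ∈ B, d ≤ #(G.nbrs X b) ∧ (#(G.nbrs X b) : ℝ) ≤ d * 2 ^ Q)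
    (hW : W ≤ ∑ b ∈ B, (#(G.nbrs A b) : ℝ)) (hW0 : 0 ≤ W) :
    ∃ i : ℕ, ∃ B' ⊆ B, (∀ b ∈ B', (2 : ℝ) ^ i * d ≤ #(G.nbrs X b) ∧
      (#(G.nbrs X b) : ℝ) ≤ 2 ^ (i + 1) * d) ∧ W / (2 * Q) ≤ ∑ b ∈ B', (#(G.nbrs A b) : ℝ) := by
  have hex : ∀ b ∈ B, ∃ i : ℕ, (2 : ℝ) ^ i ≤ #(G.nbrs X b) / d ∧
      (#(G.nbrs X b) / d : ℝ) < 2 ^ (i + 1) := fun b hb =>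
    exists_nat_pow_near (by rw [le_div_iff₀ hd]; linarith [(hB b hb).1]) (by norm_num)
  choose! f hf1 hf2 using hex
  have hmaps : ∀ b ∈ B, f b ∈ Finset.range (⌊Q⌋₊ + 1) := by
    intro b hb
    rw [Finset.mem_range, Nat.lt_succ_iff, Nat.le_floor_iff (by linarith)]
    have h1 : (2 : ℝ) ^ (f b : ℝ) ≤ 2 ^ Q := by
      rw [Real.rpow_natCast]
      refine (hf1 b hb).trans ?_
      rw [div_le_iff₀ hd, mul_comm]
      exact (hB b hb).2
    exact (Real.rpow_le_rpow_left_iff (by norm_num)).1 h1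
  by_contra! hcon
  have h1 : ∑ b ∈ B, (#(G.nbrs A b) : ℝ)
      = ∑ i ∈ Finset.range (⌊Q⌋₊ + 1), ∑ b ∈ B.filter (fun b => f b = i), (#(G.nbrs A b) : ℝ) :=
    (Finset.sum_fiberwise_of_maps_to hmaps _).symm
  have h2 : ∑ i ∈ Finset.range (⌊Q⌋₊ + 1), ∑ b ∈ B.filter (fun b => f b = i),
      (#(G.nbrs A b) : ℝ) < ∑ i ∈ Finset.range (⌊Q⌋₊ + 1), W / (2 * Q) := by
    refine Finset.sum_lt_sum_of_nonempty ⟨0, by simp⟩ fun i _ => ?_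
    refine hcon i _ (Finset.filter_subset _ _) fun b hb => ?_
    obtain ⟨hb1, rfl⟩ := Finset.mem_filter.1 hb
    exact ⟨(le_div_iff₀ hd).1 (hf1 b hb1), ((div_lt_iff₀ hd).1 (hf2 b hb1)).le⟩
  rw [Finset.sum_const, Finset.card_range, nsmul_eq_mul] at h2
  have h3 : ((⌊Q⌋₊ + 1 : ℕ) : ℝ) * (W / (2 * Q)) ≤ 2 * Q * (W / (2 * Q)) := by
    refine mul_le_mul_of_nonneg_right ?_ (by positivity)
    push_cast
    linarith [Nat.floor_le (show 0 ≤ Q by linarith)]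
  rw [mul_div_cancel₀ W (by positivity)] at h3
  linarith

/-- A graph of maximal average degree `d` contains an induced subgraph that is almost regular, or
many of its edges join vertices of low degree to vertices of huge degree. -/
lemma exists_almost_regular_or [Fintype V] {X : Finset V} {d Q : ℝ} (hne : X.Nonempty)
    (hQ : 1000 ≤ Q) (hd : 1 ≤ d) (hmax : ∀ Y ⊆ X, ∑ v ∈ Y, (#(G.nbrs Y v) : ℝ) ≤ d * #Y)
    (heq : ∑ v ∈ X, (#(G.nbrs X v) : ℝ) = d * #X) :
    (∃ H ⊆ X, H.Nonempty ∧ (∀ v ∈ H, (#(G.nbrs H v) : ℝ) ≤ 2 * (d * Q ^ 10)) ∧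
      d / (64 * Q) * #H ≤ ∑ v ∈ H, (#(G.nbrs H v) : ℝ)) ∨
    #X * d / 8 ≤ ∑ b ∈ G.highDeg X (max (d * Q ^ 10) (d * 2 ^ Q)),
      (#(G.nbrs (G.lowDeg X (d * Q ^ 10)) b) : ℝ) := by
  set D := d * Q ^ 10 with hD
  have hQ0 : 0 < Q := by linarith
  have hd0 : 0 < d := by linarith
  have hQ9 : 1000 ≤ Q ^ 9 := hQ.trans (le_self_pow₀ (by linarith) (by norm_num))
  have hQ10 : 1000 ≤ Q ^ 10 := hQ.trans (le_self_pow₀ (by linarith) (by norm_num))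
  have hD0 : 0 < D := by positivity
  have hX0 : (0 : ℝ) < #X := by exact_mod_cast hne.card_pos
  clear_value D
  set A := G.lowDeg X D with hA
  set B := G.highDeg X D with hB
  have hAm : ∀ v, v ∈ A ↔ v ∈ X ∧ (#(G.nbrs X v) : ℝ) ≤ D := fun v => mem_lowDeg
  have hBm : ∀ v, v ∈ B ↔ v ∈ X ∧ D < (#(G.nbrs X v) : ℝ) := fun v => mem_highDeg
  have hAX : A ⊆ X := Finset.filter_subset _ _
  have hBX : B ⊆ X := Finset.filter_subset _ _
  clear_value A B
  have hAB : Disjoint A B := by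
    rw [Finset.disjoint_left]
    intro v h1 h2
    exact absurd ((hBm v).1 h2).2 (not_lt.2 ((hAm v).1 h1).2)
  have hAc : (#A : ℝ) ≤ #X := by exact_mod_cast Finset.card_le_card hAX
  have hBc : (#B : ℝ) * Q ^ 10 ≤ #X := by
    have h1 : (#B : ℝ) * D ≤ ∑ v ∈ X, (#(G.nbrs X v) : ℝ) :=
      card_mul_le_sum_of_forall hBX (fun _ _ => by positivity)
        fun v hv => ((hBm v).1 hv).2.le
    rw [heq, hD] at h1
    refine le_of_mul_le_mul_left ?_ hd0
    linarith
  have hsum : d * #X ≤ ∑ v ∈ A, (#(G.nbrs A v) : ℝ) + 2 * ∑ b ∈ B, (#(G.nbrs A b) : ℝ)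
      + ∑ b ∈ B, (#(G.nbrs B b) : ℝ) := by
    have hU : X = A ∪ B := by
      ext v
      simp only [Finset.mem_union, hAm, hBm]
      have := le_or_gt (#(G.nbrs X v) : ℝ) D
      tauto
    have h0 : ∀ v, (#(G.nbrs X v) : ℝ) ≤ #(G.nbrs A v) + #(G.nbrs B v) := fun v => by
      conv_lhs => rw [hU]
      exact card_nbrs_union_le A B v
    have h1 : ∑ v ∈ X, (#(G.nbrs X v) : ℝ)
        ≤ ∑ v ∈ X, ((#(G.nbrs A v) : ℝ) + #(G.nbrs B v)) := Finset.sum_le_sum fun v _ => h0 v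
    have h2 : ∀ f : V → ℝ, ∑ v ∈ X, f v = ∑ v ∈ A, f v + ∑ v ∈ B, f v := fun f => by
      rw [hU, Finset.sum_union hAB]
    have h3 : ∑ v ∈ A, (#(G.nbrs B v) : ℝ) = ∑ b ∈ B, (#(G.nbrs A b) : ℝ) := by
      exact_mod_cast sum_card_nbrs_comm A B
    rw [heq, h2, Finset.sum_add_distrib, Finset.sum_add_distrib, h3] at h1
    linarith
  -- Maximality of `d` applied to the few vertices of high degree.
  have hBB : ∑ b ∈ B, (#(G.nbrs B b) : ℝ) ≤ d * #X / 4 := by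
    refine (hmax B hBX).trans ?_
    have h1 : (#B : ℝ) * 4 ≤ #B * Q ^ 10 := by gcongr; linarith
    have h2 : (#B : ℝ) * 4 ≤ #X := h1.trans hBc
    nlinarith
  by_cases hc1 : d * #X / 4 ≤ ∑ v ∈ A, (#(G.nbrs A v) : ℝ)
  · left
    refine ⟨A, hAX, ?_, fun v hv => ?_, le_trans ?_ hc1⟩
    · by_contra h
      rw [Finset.not_nonempty_iff_eq_empty.1 h, Finset.sum_empty] at hc1
      have : 0 < d * (#X : ℝ) / 4 := by positivity
      linarith
    · have h1 := card_nbrs_mono (G := G) hAX v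
      have h2 := ((hAm v).1 hv).2
      linarith
    · calc d / (64 * Q) * #A ≤ d / 4 * #X := by
            gcongr
            linarith
        _ = d * #X / 4 := by ring
  have heAB : d * #X / 4 ≤ ∑ b ∈ B, (#(G.nbrs A b) : ℝ) := by linarith
  -- The maximum keeps this set disjoint from `A` without comparing `2 ^ Q` with `Q ^ 10`.
  set Bhi := G.highDeg X (max D (d * 2 ^ Q)) with hBhi
  by_cases hc2 : #X * d / 8 ≤ ∑ b ∈ Bhi, (#(G.nbrs A b) : ℝ)
  · exact Or.inr hc2
  left
  set Blo := B.filter fun b => (#(G.nbrs X b) : ℝ) ≤ d * 2 ^ Q with hBlo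
  have hlo : #X * d / 8 ≤ ∑ b ∈ Blo, (#(G.nbrs A b) : ℝ) := by
    have h1 := Finset.sum_filter_add_sum_filter_not B
      (fun b => (#(G.nbrs X b) : ℝ) ≤ d * 2 ^ Q) fun b => (#(G.nbrs A b) : ℝ)
    have h2 : (B.filter fun b => ¬ (#(G.nbrs X b) : ℝ) ≤ d * 2 ^ Q) = Bhi := by
      ext b
      simp only [Finset.mem_filter, hBm, hBhi, mem_highDeg, not_le, max_lt_iff]
      tauto
    rw [h2] at h1
    linarith
  obtain ⟨i, Bi, hBi, hBid, hBie⟩ := exists_dyadic_class (X := X) (A := A) (by linarith) hd0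
    (B := Blo) (Q := Q) (W := #X * d / 8) (fun b hb => by
      obtain ⟨h1, h2⟩ := Finset.mem_filter.1 hb
      refine ⟨le_trans ?_ ((hBm b).1 h1).2.le, h2⟩
      rw [hD]
      nlinarith) hlo (by positivity)
  have hBiB : Bi ⊆ B := hBi.trans (Finset.filter_subset _ _)
  have hBic : (#Bi : ℝ) * 2 ^ i ≤ #X := by
    have h1 : (#Bi : ℝ) * (2 ^ i * d) ≤ ∑ v ∈ X, (#(G.nbrs X v) : ℝ) :=
      card_mul_le_sum_of_forall (hBiB.trans hBX) (fun _ _ => by positivity)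
        fun v hv => (hBid v hv).1
    rw [heq] at h1
    refine le_of_mul_le_mul_left ?_ hd0
    linarith
  have hBiA : ∀ b ∈ Bi, (#(G.nbrs A b) : ℝ) ≤ 2 ^ (i + 1) * d := fun b hb =>
    (card_nbrs_mono hAX b).trans (hBid b hb).2
  -- Vertices of large degree inside their own class. By maximality they are at most a `Q ^ (-10)`
  -- proportion of it, and since degrees in the class agree up to a factor `2` they carry at most
  -- half of the `#X * d / (16 Q)` guaranteed.
  set R := Bi.filter fun b => ¬ (#(G.nbrs Bi b) : ℝ) ≤ D with hR
  set Bi' := Bi.filter fun b => (#(G.nbrs Bi b) : ℝ) ≤ D with hBi'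
  have hRc : (#R : ℝ) * Q ^ 10 ≤ #Bi := by
    have h1 : (#R : ℝ) * D ≤ ∑ v ∈ Bi, (#(G.nbrs Bi v) : ℝ) :=
      card_mul_le_sum_of_forall (Finset.filter_subset _ _) (fun _ _ => by positivity)
        fun v hv => (not_le.1 (Finset.mem_filter.1 hv).2).le
    have h2 := h1.trans (hmax Bi (hBiB.trans hBX))
    rw [hD] at h2
    refine le_of_mul_le_mul_left ?_ hd0
    linarith
  have hRe : ∑ b ∈ R, (#(G.nbrs A b) : ℝ) ≤ #X * d / (32 * Q) := by
    have h1 : ∑ b ∈ R, (#(G.nbrs A b) : ℝ) ≤ #R * (2 ^ (i + 1) * d) :=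
      sum_le_card_mul fun b hb => hBiA b (Finset.filter_subset _ _ hb)
    refine h1.trans ?_
    rw [le_div_iff₀ (by positivity)]
    calc (#R : ℝ) * (2 ^ (i + 1) * d) * (32 * Q) = (#R * (64 * Q)) * 2 ^ i * d := by ring
      _ ≤ (#R * Q ^ 10) * 2 ^ i * d := by
          gcongr
          calc 64 * Q ≤ Q ^ 9 * Q := by gcongr; linarith
            _ = Q ^ 10 := by ring
      _ ≤ #Bi * 2 ^ i * d := by gcongr
      _ ≤ #X * d := by gcongr
  have hBi'e : #X * (d / (32 * Q)) ≤ ∑ b ∈ Bi', (#(G.nbrs A b) : ℝ) := by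
    have h1 := Finset.sum_filter_add_sum_filter_not Bi
      (fun b => (#(G.nbrs Bi b) : ℝ) ≤ D) fun b => (#(G.nbrs A b) : ℝ)
    have h2 : #X * d / 8 / (2 * Q) = 2 * (#X * (d / (32 * Q))) := by field_simp; ring
    have h3 : #X * d / (32 * Q) = #X * (d / (32 * Q)) := by ring
    rw [h2] at hBie
    rw [h3] at hRe
    linarith
  -- The class has at most `#X / 2 ^ i` vertices, of degree at most `2 ^ (i + 1) * d`. Sampling `A`
  -- at rate `2 ^ (-i)` balances the sides and brings expected degrees down to at most `2 * d`.
  obtain ⟨S, hSA, B', hB', hB'D, hB'e⟩ := exists_balanced (A := A) (B := Bi') (p := (1 / 2) ^ i)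
    (d := d / (32 * Q)) (n := #X) (D := D) (L := 2 ^ (i + 1) * d) (by positivity)
    (pow_le_one₀ (by norm_num) (by norm_num)) hX0 (by positivity) hAc
    (by
      rw [one_div, inv_pow, ← div_eq_mul_inv, le_div_iff₀ (by positivity)]
      refine le_trans ?_ hBic
      gcongr
      exact Finset.filter_subset _ _)
    (fun b hb => hBiA b (Finset.filter_subset _ _ hb)) (by positivity)
    (by
      have h1 : (1 / 2 : ℝ) ^ i * (2 ^ (i + 1) * d) = 2 * d := by
        rw [pow_succ, one_div, inv_pow]
        field_simp
      rw [h1, hD]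
      nlinarith) hBi'e
  have hB'Bi : B' ⊆ Bi := hB'.trans (Finset.filter_subset _ _)
  have hdis : Disjoint S B' := Finset.disjoint_of_subset_left hSA
    (Finset.disjoint_of_subset_right (hB'Bi.trans hBiB) hAB)
  have hHX : S ∪ B' ⊆ X :=
    Finset.union_subset (hSA.trans hAX) (hB'Bi.trans (hBiB.trans hBX))
  have hge := sum_card_nbrs_union_ge (G := G) hdis
  refine ⟨S ∪ B', hHX, ?_, fun v hv => ?_, ?_⟩
  · by_contra h
    have h1 := Finset.not_nonempty_iff_eq_empty.1 h
    rw [Finset.union_eq_empty] at h1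
    rw [h1.1, h1.2] at hB'e
    simp at hB'e
  · rcases Finset.mem_union.1 hv with h | h
    · have h1 := card_nbrs_mono (G := G) hHX v
      have h2 := ((hAm v).1 (hSA h)).2
      linarith
    · have h1 := card_nbrs_union_le (G := G) S B' v
      have h2 := hB'D v h
      have h3 := card_nbrs_mono (G := G) hB'Bi v
      have h4 : (#(G.nbrs Bi v) : ℝ) ≤ D := (Finset.mem_filter.1 (hB' h)).2
      linarith
  · rw [Finset.card_union_of_disjoint hdis]
    push_cast
    have : d / (64 * Q) * ((#S : ℝ) + #B') = 2 * (d / (32 * Q) / 4 * (#S + #B')) := by ring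
    linarith

end Dichotomy

/-! ### The bipartite subgraph in the unbalanced case -/

section Unbalanced

variable {V : Type*} {G : SimpleGraph V}

/-- Large independent sets inside a vertex set of a graph without large bicliques. -/
lemma NoBiclique.exists_independent {s : ℕ} (hs : 1 ≤ s) (hG : G.NoBiclique s) {M : Finset V}
    {z : ℝ} (hz : 0 < z) (hzM : z ^ s ≤ #M) (hsz : s * z ≤ #M) :
    ∃ I ⊆ M, z / 14 ≤ #I ∧ ∀ v ∈ I, ∀ w ∈ I, ¬ G.Adj v w := by
  have hM0 : (0 : ℝ) < #M := lt_of_lt_of_le (by positivity) hzM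
  have hs' : (1 : ℝ) ≤ s := by exact_mod_cast hs
  have hzle : z ≤ #M := le_trans (by nlinarith) hsz
  have hkst := hG.sum_card_nbrs_le hs hz hzM hsz (X := M) (Y := M) le_rfl le_rfl
  -- The threshold is twice the average degree allowed by Kővári–Sós–Turán, so at least half of `M`
  -- remains; greedy selection then yields `(#M / 2) / (7 #M / z) = z / 14` vertices.
  set M' := M.filter fun v => ¬ 6 * #M / z < (#(G.nbrs M v) : ℝ) with hM'
  have hbad : (#(M.filter fun v => 6 * #M / z < (#(G.nbrs M v) : ℝ)) : ℝ) * (6 * #M / z)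
      ≤ 3 * #M ^ 2 / z :=
    (card_mul_le_sum_of_forall (Finset.filter_subset _ _) (fun _ _ => by positivity)
      fun v hv => (Finset.mem_filter.1 hv).2.le).trans hkst
  have hbad' : 2 * (#(M.filter fun v => 6 * #M / z < (#(G.nbrs M v) : ℝ)) : ℝ) ≤ #M := by
    refine le_of_mul_le_mul_right ?_ (show (0 : ℝ) < 3 * #M / z by positivity)
    calc 2 * (#(M.filter fun v => 6 * #M / z < (#(G.nbrs M v) : ℝ)) : ℝ) * (3 * #M / z)
        = #(M.filter fun v => 6 * #M / z < (#(G.nbrs M v) : ℝ)) * (6 * #M / z) := by ring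
      _ ≤ _ := hbad
      _ = #M * (3 * #M / z) := by ring
  have hsplit : (#(M.filter fun v => 6 * #M / z < (#(G.nbrs M v) : ℝ)) : ℝ) + #M' = #M := by
    rw [← Nat.cast_add, hM', Finset.card_filter_add_card_filter_not]
  obtain ⟨I, hI, hIc, hIi⟩ := exists_independent_of_degree_le (r := G.Adj)
    (fun _ _ h => h.symm) (q := 6 * #M / z) M' (fun v hv => by
      refine le_trans ?_ (not_lt.1 (Finset.mem_filter.1 hv).2)
      have : (M'.filter fun w => w ≠ v ∧ G.Adj v w) ⊆ G.nbrs M v := by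
        intro w hw
        obtain ⟨h1, -, h2⟩ := Finset.mem_filter.1 hw
        exact mem_nbrs.2 ⟨Finset.filter_subset _ _ h1, h2⟩
      exact_mod_cast Finset.card_le_card this)
  refine ⟨I, hI.trans (Finset.filter_subset _ _), ?_, fun v hv w hw h => hIi v hv w hw h.ne h⟩
  have h1 : 6 * #M / z + 1 ≤ 7 * #M / z := by
    have : 1 ≤ (#M : ℝ) / z := (one_le_div hz).2 hzle
    have h2 : 6 * #M / z = 6 * ((#M : ℝ) / z) := by ring
    have h3 : 7 * #M / z = 7 * ((#M : ℝ) / z) := by ring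
    linarith
  have h2 : (#M : ℝ) ≤ 2 * (7 * #M / z * #I) := by
    have : (6 * #M / z + 1) * #I ≤ 7 * #M / z * (#I : ℝ) := by gcongr
    linarith
  have h3 : (#M : ℝ) * 1 ≤ #M * (14 / z * #I) := by
    calc (#M : ℝ) * 1 = #M := mul_one _
      _ ≤ _ := h2
      _ = #M * (14 / z * #I) := by ring
  have h4 := le_of_mul_le_mul_left h3 hM0
  rw [div_le_iff₀ (by norm_num)]
  rw [div_mul_eq_mul_div, le_div_iff₀ hz] at h4
  linarith

/-- The induced bipartite subgraph found when many edges join vertices of low degree to vertices of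
huge degree. -/
lemma exists_bipartite_of_unbalanced [Fintype V] {s k : ℕ} (hs : 1 ≤ s) (hk : 1 ≤ k)
    (hG : G.NoBiclique s) {X : Finset V} {d Q R : ℝ} (hne : X.Nonempty) (hQ : 1 ≤ Q) (hd : 1 ≤ d)
    (hmax : ∀ Y ⊆ X, ∑ v ∈ Y, (#(G.nbrs Y v) : ℝ) ≤ d * #Y)
    (heq : ∑ v ∈ X, (#(G.nbrs X v) : ℝ) = d * #X)
    (he : #X * d / 8 ≤ ∑ b ∈ G.highDeg X (max (d * Q ^ 10) (d * 2 ^ Q)),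
      (#(G.nbrs (G.lowDeg X (d * Q ^ 10)) b) : ℝ))
    (hQd : 32 * Q ^ s ≤ d) (hsQ : 32 * (s * Q) ≤ d) (hkQ : 14 * (2 * k : ℝ) ^ s ≤ Q)
    (hR : R = 4 * (16 * Q ^ 10 * (2 * (d * Q ^ 10)) ^ s) * (d * Q ^ 10) * (1 + k ^ 2) *
      (2 * (d * Q ^ 10 + k * d)) ^ k)
    (hΔ : (d * Q ^ 10 + 1) * R ^ s ≤ d * 2 ^ Q / 32) :
    ∃ A' ⊆ X, ∃ B' ⊆ X, Disjoint A' B' ∧ A'.Nonempty ∧ #B' ≤ #A' ∧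
      (∀ a ∈ A', ∀ a' ∈ A', ¬ G.Adj a a') ∧ (∀ b ∈ B', ∀ b' ∈ B', ¬ G.Adj b b') ∧
      (∀ a ∈ A', #(G.nbrs B' a) = k) ∧
      ∀ a ∈ A', ∀ a' ∈ A', a ≠ a' → ∀ b ∈ B', ∀ b' ∈ B', G.Adj a b → G.Adj a b' →
        G.Adj a' b → G.Adj a' b' → b = b' := by
  set D := d * Q ^ 10 with hD
  set Θ : ℝ := d * 2 ^ Q with hΘ
  have hQ0 : 0 < Q := by linarith
  have hd0 : 0 < d := by linarith
  have hQ10 : 1 ≤ Q ^ 10 := one_le_pow₀ hQ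
  have hdD : d ≤ D := by rw [hD]; nlinarith
  have hD1 : 1 ≤ D := hd.trans hdD
  have hΘ0 : 0 < Θ := by positivity
  have hX0 : (0 : ℝ) < #X := by exact_mod_cast hne.card_pos
  have hkR : (1 : ℝ) ≤ k := by exact_mod_cast hk
  have hsR : (1 : ℝ) ≤ s := by exact_mod_cast hs
  clear_value D Θ
  set A := G.lowDeg X D with hA
  set Bhi := G.highDeg X (max D Θ) with hBhi
  have hAX : A ⊆ X := Finset.filter_subset _ _
  have hBX : Bhi ⊆ X := Finset.filter_subset _ _
  have hAc : (#A : ℝ) ≤ #X := by exact_mod_cast Finset.card_le_card hAX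
  have hADeg : ∀ a ∈ A, ∀ Y ⊆ X, (#(G.nbrs Y a) : ℝ) ≤ D := fun a ha Y hY =>
    (card_nbrs_mono hY a).trans (mem_lowDeg.1 ha).2
  have hBc : (#Bhi : ℝ) * Θ ≤ #X * d := by
    have h1 : (#Bhi : ℝ) * Θ ≤ ∑ v ∈ X, (#(G.nbrs X v) : ℝ) :=
      card_mul_le_sum_of_forall hBX (fun _ _ => by positivity)
        fun v hv => (max_lt_iff.1 (mem_highDeg.1 hv).2).2.le
    rw [heq] at h1
    linarith
  -- As `#Bhi * Θ ≤ #X * d`, this filter loses at most `1/32` of `#X * d`. The filter defining `A₁`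
  -- loses another `1/32`, which leaves `1/16` of the initial `1/8`.
  set B₁ := Bhi.filter fun b => Θ / 32 ≤ (#(G.nbrs A b) : ℝ) with hB₁
  have hB₁X : B₁ ⊆ X := (Finset.filter_subset _ _).trans hBX
  have hB₁e : 3 * (#X * d) / 32 ≤ ∑ b ∈ B₁, (#(G.nbrs A b) : ℝ) := by
    have h1 := Finset.sum_filter_add_sum_filter_not Bhi
      (fun b => Θ / 32 ≤ (#(G.nbrs A b) : ℝ)) fun b => (#(G.nbrs A b) : ℝ)
    have h2 : ∑ b ∈ Bhi.filter (fun b => ¬ Θ / 32 ≤ (#(G.nbrs A b) : ℝ)), (#(G.nbrs A b) : ℝ)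
        ≤ #Bhi * (Θ / 32) := by
      refine (sum_le_card_mul fun b hb => (not_le.1 (Finset.mem_filter.1 hb).2).le).trans ?_
      gcongr
      exact Finset.filter_subset _ _
    linarith
  set A₁ := A.filter fun a => d / 32 ≤ (#(G.nbrs B₁ a) : ℝ) with hA₁
  have hA₁A : A₁ ⊆ A := Finset.filter_subset _ _
  have hA₁c : #X * d ≤ 16 * (#A₁ * D) := by
    have h0 : ∑ b ∈ B₁, (#(G.nbrs A b) : ℝ) = ∑ a ∈ A, (#(G.nbrs B₁ a) : ℝ) := by
      exact_mod_cast sum_card_nbrs_comm B₁ A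
    have h1 := Finset.sum_filter_add_sum_filter_not A
      (fun a => d / 32 ≤ (#(G.nbrs B₁ a) : ℝ)) fun a => (#(G.nbrs B₁ a) : ℝ)
    have h2 : ∑ a ∈ A.filter (fun a => ¬ d / 32 ≤ (#(G.nbrs B₁ a) : ℝ)), (#(G.nbrs B₁ a) : ℝ)
        ≤ #X * (d / 32) := by
      refine (sum_le_card_mul fun b hb => (not_le.1 (Finset.mem_filter.1 hb).2).le).trans ?_
      gcongr
      exact (Finset.filter_subset _ _).trans hAX
    have h3 : ∑ a ∈ A₁, (#(G.nbrs B₁ a) : ℝ) ≤ #A₁ * D :=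
      sum_le_card_mul fun a ha => hADeg a (hA₁A ha) B₁ hB₁X
    linarith
  have hA₁ne : A₁.Nonempty := by
    by_contra h
    rw [Finset.not_nonempty_iff_eq_empty.1 h] at hA₁c
    have : 0 < #X * d := by positivity
    simp only [Finset.card_empty, Nat.cast_zero, zero_mul, mul_zero] at hA₁c
    linarith
  have hA₁w : (#A : ℝ) ≤ 16 * Q ^ 10 * #A₁ := by
    refine hAc.trans (le_of_mul_le_mul_right (hA₁c.trans (le_of_eq ?_)) hd0)
    rw [hD]
    ring
  have hIex : ∀ a ∈ A₁, ∃ I ⊆ G.nbrs B₁ a, Q / 14 ≤ #I ∧ ∀ v ∈ I, ∀ w ∈ I, ¬ G.Adj v w := by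
    intro a ha
    have h1 : d / 32 ≤ (#(G.nbrs B₁ a) : ℝ) := (Finset.mem_filter.1 ha).2
    exact hG.exists_independent hs hQ0 (by linarith) (by linarith)
  choose! I hIB hIc hIi using hIex
  have hR1 : 1 ≤ R := by
    rw [hR]
    have h1 : 1 ≤ (2 * D) ^ s := one_le_pow₀ (by linarith)
    have h2 : 1 ≤ (2 * (D + k * d)) ^ k := one_le_pow₀ (by nlinarith)
    have h3 : 1 ≤ 4 * (16 * Q ^ 10 * (2 * D) ^ s) := by nlinarith
    have h4 : (1 : ℝ) ≤ 1 + (k : ℝ) ^ 2 := by nlinarith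
    exact one_le_mul_of_one_le_of_one_le (one_le_mul_of_one_le_of_one_le
      (one_le_mul_of_one_le_of_one_le h3 hD1) h4) h2
  have hR0 : 0 < R := by linarith
  -- Codegree thresholds falling by the factor `R`, which is exactly the ratio that
  -- `exists_bipartite_of_spread` needs between degrees and pairwise codegrees. By `hΔ` they stay
  -- above `D + 1` for all `t ≤ s`.
  set Δ : ℕ → ℝ := fun t => Θ / 32 / R ^ t with hΔdef
  have hΔge : ∀ t ≤ s, D + 1 ≤ Δ t := by
    intro t ht
    simp only [hΔdef]
    rw [le_div_iff₀ (by positivity)]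
    refine le_trans ?_ hΔ
    gcongr
  have hΔsucc : ∀ t, Δ t = R * Δ (t + 1) := by
    intro t
    simp only [hΔdef]
    rw [pow_succ]
    field_simp
  have hsD : (s : ℝ) ≤ D := by nlinarith
  obtain ⟨t, hts, T, A₂, hA₂T, hA₂A₁, hA₂ne, hA₂w, hA₂S⟩ := exists_spread_family (Δ := Δ)
    (A := A) (B := B₁) (A₀ := A₁) (I := I) (D := D) (w := 16 * Q ^ 10) (m := Q / 14) hs hk hG
    (by linarith) (by positivity) (fun a ha => hADeg a ha B₁ hB₁X) hIB hA₁A hA₁ne hA₁w hIc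
    (fun a ha b hb => by
      have := (Finset.mem_filter.1 (mem_nbrs.1 (hIB a ha hb)).1).2
      simpa [hΔdef] using this)
    (fun t ht => by
      rw [le_div_iff₀ (by positivity)]
      have h1 : (2 * k : ℝ) * (2 * k) ^ t ≤ (2 * k) ^ s := by
        rw [← pow_succ']
        exact pow_le_pow_right₀ (by linarith) (by omega)
      linarith)
    (by linarith [hΔge (s - 1) (by omega)])
  choose! S hSI hSk hSp using hA₂S
  obtain ⟨out, hout1, hout2, hout3⟩ := exists_orientation X hmax
  have hcT : G.commonNbrs A T ⊆ A := fun a ha => (mem_commonNbrs.1 ha).1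
  have hHB : G.heavy A T (Δ t) B₁ ⊆ B₁ := Finset.filter_subset _ _
  have hHX : G.heavy A T (Δ t) B₁ ⊆ X := hHB.trans hB₁X
  have hΔt : D + 1 ≤ Δ t := hΔge t (by omega)
  have hΔt' : D + 1 ≤ Δ (t + 1) := hΔge (t + 1) (by omega)
  obtain ⟨A', hA', B', hB', h1, h2, h3, h4, h5, h6⟩ := exists_bipartite_of_spread
    (A₀ := G.commonNbrs A T) (B₀ := G.heavy A T (Δ t) B₁) (A₁ := A₂) (S := S) (out := out)
    (Δ := Δ t) (Δ' := Δ (t + 1)) (D := D) (w := 2 * (16 * Q ^ 10 * (2 * D) ^ t)) (q := d) (k := k)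
    hD1 (by positivity) hd0.le (by linarith) (by linarith) hA₂T hA₂ne hA₂w
    (fun b hb => by
      refine (mem_heavy.1 hb).2.2.trans ?_
      have : G.commonNbrs A (insert b T) ⊆ G.nbrs (G.commonNbrs A T) b := by
        intro a ha
        simp only [mem_commonNbrs, Finset.forall_mem_insert, mem_nbrs] at ha ⊢
        exact ⟨⟨ha.1, ha.2.2⟩, ha.2.1.symm⟩
      exact_mod_cast Finset.card_le_card this)
    (fun a ha => hADeg a (hcT ha) _ hHX)
    (fun a ha => hADeg a (hcT ha) _ (hcT.trans hAX))
    (fun a ha b hb => by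
      have hb1 := mem_heavy.1 (hSI a ha hb)
      have hb2 := mem_nbrs.1 (hIB a (hA₂A₁ ha) hb1.1)
      exact mem_nbrs.2 ⟨mem_heavy.2 ⟨hb2.1, hb1.2⟩, hb2.2⟩)
    hSk
    (fun a ha b hb b' hb' => hIi a (hA₂A₁ ha) b (mem_heavy.1 (hSI a ha hb)).1 b'
      (mem_heavy.1 (hSI a ha hb')).1)
    (fun a ha b hb b' hb' hbb => by
      refine le_trans ?_ (hSp a ha b hb b' hb' hbb).le
      have : G.commonNbrs (G.commonNbrs A T) {b, b'} ⊆ G.commonNbrs A (insert b (insert b' T)) := by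
        intro x hx
        simp only [mem_commonNbrs, Finset.forall_mem_insert, Finset.mem_singleton,
          forall_eq] at hx ⊢
        exact ⟨hx.1.1, hx.2.1, hx.2.2, hx.1.2⟩
      exact_mod_cast Finset.card_le_card this)
    (fun b hb => hout1 b (hHX hb)) (fun b hb => hout2 b (hHX hb))
    (fun b hb b' hb' => hout3 b (hHX hb) b' (hHX hb'))
    (by
      have hP : 0 < (2 * (D + k * d)) ^ k := by positivity
      have hpow : (2 * D) ^ t ≤ (2 * D) ^ s := pow_le_pow_right₀ (by linarith) (by omega)
      rw [one_div, inv_pow, inv_mul_eq_div, le_div_iff₀ hP, hΔsucc t]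
      calc 2 * (2 * (16 * Q ^ 10 * (2 * D) ^ t) * D) * (D + k ^ 2 * Δ (t + 1) + 1)
            * (2 * (D + k * d)) ^ k
          ≤ 2 * (2 * (16 * Q ^ 10 * (2 * D) ^ s) * D) * ((1 + k ^ 2) * Δ (t + 1))
            * (2 * (D + k * d)) ^ k := by
            gcongr
            linarith
        _ = R * Δ (t + 1) := by rw [hR]; ring)
  have hA'A : A' ⊆ A := hA'.trans (hA₂T.trans hcT)
  refine ⟨A', hA'A.trans hAX, B', hB'.trans hHX, ?_, h1, h2, h3, h4, h5, h6⟩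
  rw [Finset.disjoint_left]
  intro v hv1 hv2
  have e1 := (mem_lowDeg.1 (hA'A hv1)).2
  have e2 : v ∈ Bhi := Finset.filter_subset _ _ (hHB (hB' hv2))
  exact absurd (max_lt_iff.1 (mem_highDeg.1 e2).2).1 (not_lt.2 e1)

end Unbalanced

/-! ### Passing between degree sums and induced subgraphs -/

section Conversion

variable {V : Type*} {G : SimpleGraph V}

lemma noBiclique_of_free {s : ℕ} (h : (completeBipartiteGraph (Fin s) (Fin s)).Free G) :
    G.NoBiclique s := by
  intro T U hT hU hTU
  refine h (completeBipartiteGraph_isContained_iff.2 ⟨T, U, by simpa using hT, by simpa using hU, ?_⟩)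
  exact fun t ht u hu => hTU t ht u hu

lemma card_nbrs_univ [Fintype V] (v : V) : #(G.nbrs univ v) = G.degree v := by
  rw [← card_neighborFinset_eq_degree]
  congr 1
  ext w
  simp

lemma avgDeg_eq [Fintype V] :
    G.avgDeg = (∑ v, (#(G.nbrs univ v) : ℝ)) / Fintype.card V := by
  have h : ∑ v, #(G.nbrs univ v) = 2 * G.edgeSet.ncard := by
    rw [Finset.sum_congr rfl fun v _ => card_nbrs_univ v, sum_degrees_eq_twice_card_edges,
      Set.ncard_eq_toFinset_card' G.edgeSet]
    rfl
  rw [avgDeg]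
  congr 1
  exact_mod_cast h.symm

lemma card_nbrs_induce (S : Finset V) [Fintype (S : Set V)] (v : (S : Set V)) :
    #((G.induce (S : Set V)).nbrs univ v) = #(G.nbrs S v) := by
  refine Finset.card_bij (fun w _ => (w : V)) (fun w hw => ?_) (fun _ _ _ _ h => Subtype.ext h)
    fun w hw => ?_
  · simp only [mem_nbrs, Finset.mem_univ, true_and, comap_adj, Function.Embedding.subtype_apply]
      at hw ⊢
    exact ⟨w.2, hw⟩
  · obtain ⟨h1, h2⟩ := mem_nbrs.1 hw
    exact ⟨⟨w, h1⟩, by simpa using h2, rfl⟩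

lemma le_avgDeg_induce {S : Finset V} [Fintype (S : Set V)] (hS : S.Nonempty) {c : ℝ}
    (h : c * #S ≤ ∑ v ∈ S, (#(G.nbrs S v) : ℝ)) : c ≤ (G.induce (S : Set V)).avgDeg := by
  have hc : Fintype.card (S : Set V) = #S := by
    rw [← Nat.card_eq_fintype_card]
    simp
  have hsum : ∑ v : (S : Set V), (#((G.induce (S : Set V)).nbrs univ v) : ℝ)
      = ∑ v ∈ S, (#(G.nbrs S v) : ℝ) := by
    rw [Finset.sum_congr rfl fun v _ => by rw [card_nbrs_induce S v]]
    exact Finset.sum_bij (fun v _ => (v : V)) (fun v _ => v.2) (fun _ _ _ _ h => Subtype.ext h)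
      (fun v hv => ⟨⟨v, hv⟩, Finset.mem_univ _, rfl⟩) fun _ _ => rfl
  rw [avgDeg_eq, hsum, hc, le_div_iff₀ (by exact_mod_cast hS.card_pos)]
  exact h

lemma maxDeg_induce_le {S : Finset V} [Fintype (S : Set V)] {c : ℝ} (hc : 0 ≤ c)
    (h : ∀ v ∈ S, (#(G.nbrs S v) : ℝ) ≤ c) : ((G.induce (S : Set V)).maxDeg : ℝ) ≤ c := by
  refine le_trans ?_ (Nat.floor_le hc)
  refine Nat.cast_le.2 (maxDegree_le_of_forall_degree_le _ _ fun v => ?_)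
  rw [← card_nbrs_univ, card_nbrs_induce]
  exact Nat.le_floor (h v v.2)

lemma card_nbrs_le_maxDeg [Fintype V] (X : Finset V) (v : V) :
    (#(G.nbrs X v) : ℝ) ≤ G.maxDeg := by
  refine (card_nbrs_mono (Finset.subset_univ X) v).trans ?_
  rw [card_nbrs_univ]
  exact_mod_cast G.degree_le_maxDegree v

lemma c3c4Free_induce {S : Finset V}
    (h3 : ∀ u ∈ S, ∀ v ∈ S, ∀ w ∈ S, G.Adj u v → G.Adj u w → ¬ G.Adj v w)
    (h4 : ∀ a ∈ S, ∀ b ∈ S, ∀ x ∈ S, ∀ y ∈ S, a ≠ x → b ≠ y → G.Adj a b → G.Adj b x →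
      G.Adj x y → ¬ G.Adj a y) : (G.induce (S : Set V)).C3C4Free := by
  constructor
  · rintro ⟨f⟩
    have hadj : ∀ i j, (cycleGraph 3).Adj i j → G.Adj (f i : V) (f j : V) := fun i j h =>
      f.toHom.map_adj h
    exact h3 (f 0) (f 0).2 (f 1) (f 1).2 (f 2) (f 2).2
      (hadj 0 1 (by rw [cycleGraph_adj]; decide)) (hadj 0 2 (by rw [cycleGraph_adj]; decide))
      (hadj 1 2 (by rw [cycleGraph_adj]; decide))
  · rintro ⟨f⟩
    have hadj : ∀ i j, (cycleGraph 4).Adj i j → G.Adj (f i : V) (f j : V) := fun i j h =>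
      f.toHom.map_adj h
    have hne : ∀ i j, i ≠ j → (f i : V) ≠ f j := fun i j h e =>
      h (f.injective' (Subtype.ext e))
    exact h4 (f 0) (f 0).2 (f 1) (f 1).2 (f 2) (f 2).2 (f 3) (f 3).2
      (hne 0 2 (by decide)) (hne 1 3 (by decide))
      (hadj 0 1 (by rw [cycleGraph_adj]; decide)) (hadj 1 2 (by rw [cycleGraph_adj]; decide))
      (hadj 2 3 (by rw [cycleGraph_adj]; decide)) (hadj 0 3 (by rw [cycleGraph_adj]; decide))

/-- Some induced subgraph has maximal average degree. -/
lemma exists_max_avg [Fintype V] [Nonempty V] (G : SimpleGraph V) :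
    ∃ X : Finset V, X.Nonempty ∧ ∃ d : ℝ, G.avgDeg ≤ d ∧
      (∀ Y ⊆ X, ∑ v ∈ Y, (#(G.nbrs Y v) : ℝ) ≤ d * #Y) ∧
      ∑ v ∈ X, (#(G.nbrs X v) : ℝ) = d * #X := by
  obtain ⟨X, hX, hmax⟩ := Finset.exists_max_image
    (univ.filter fun Y : Finset V => Y.Nonempty) (fun Y => (∑ v ∈ Y, (#(G.nbrs Y v) : ℝ)) / #Y)
    ⟨univ, by simp⟩
  have hXne : X.Nonempty := by simpa using hX
  have hX0 : (0 : ℝ) < #X := by exact_mod_cast hXne.card_pos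
  refine ⟨X, hXne, (∑ v ∈ X, (#(G.nbrs X v) : ℝ)) / #X, ?_, fun Y _ => ?_, ?_⟩
  · rw [avgDeg_eq]
    exact hmax univ (by simp)
  · rcases Y.eq_empty_or_nonempty with rfl | hY
    · simp
    have hY0 : (0 : ℝ) < #Y := by exact_mod_cast hY.card_pos
    rw [← div_le_iff₀ hY0]
    exact hmax Y (by simpa using hY)
  · field_simp

/-- Bipartite pieces as produced above are induced bipartite graphs without 3- and 4-cycles. -/
lemma bipartite_piece {A B : Finset V} [Fintype ((A ∪ B : Finset V) : Set V)] {k : ℕ}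
    (hAB : Disjoint A B) (hne : A.Nonempty)
    (hc : #B ≤ #A) (hA : ∀ a ∈ A, ∀ a' ∈ A, ¬ G.Adj a a') (hB : ∀ b ∈ B, ∀ b' ∈ B, ¬ G.Adj b b')
    (hk : ∀ a ∈ A, #(G.nbrs B a) = k)
    (h4 : ∀ a ∈ A, ∀ a' ∈ A, a ≠ a' → ∀ b ∈ B, ∀ b' ∈ B, G.Adj a b → G.Adj a b' →
        G.Adj a' b → G.Adj a' b' → b = b') :
    (G.induce ((A ∪ B : Finset V) : Set V)).C3C4Free ∧
      (k : ℝ) ≤ (G.induce ((A ∪ B : Finset V) : Set V)).avgDeg ∧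
      (G.induce ((A ∪ B : Finset V) : Set V)).IsBipartite := by
  have hcross : ∀ v ∈ A ∪ B, ∀ w ∈ A ∪ B, G.Adj v w → (v ∈ A ∧ w ∈ B) ∨ (v ∈ B ∧ w ∈ A) := by
    intro v hv w hw h
    rcases Finset.mem_union.1 hv with hv | hv <;> rcases Finset.mem_union.1 hw with hw | hw
    · exact absurd h (hA v hv w hw)
    · exact Or.inl ⟨hv, hw⟩
    · exact Or.inr ⟨hv, hw⟩
    · exact absurd h (hB v hv w hw)
  have hnot : ∀ v, v ∈ A → v ∉ B := fun _ h => Finset.disjoint_left.1 hAB h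
  refine ⟨c3c4Free_induce ?_ ?_, ?_, ?_⟩
  · intro u hu v hv w hw huv huw hvw
    have h1 := hcross u hu v hv huv
    have h2 := hcross u hu w hw huw
    have h3 := hcross v hv w hw hvw
    have := hnot u
    have := hnot v
    have := hnot w
    tauto
  -- A 4-cycle alternates between the sides, so two opposite vertices lie in `A` and `h4` identifies
  -- the other two.
  · intro a ha b hb x hx y hy hax hby hab hbx hxy hay
    rcases hcross a ha b hb hab with h1 | h1
    · have h2 := (hcross b hb x hx hbx).resolve_left fun h => hnot b h.1 h1.2
      have h3 := (hcross x hx y hy hxy).resolve_right fun h => hnot x h2.2 h.1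
      exact hby (h4 a h1.1 x h2.2 hax b h1.2 y h3.2 hab hay hbx.symm hxy)
    · have h2 := (hcross b hb x hx hbx).resolve_right fun h => hnot b h1.2 h.1
      have h3 := (hcross x hx y hy hxy).resolve_left fun h => hnot x h.1 h2.2
      exact hax (h4 b h1.2 y h3.2 hby a h1.1 x h2.2 hab.symm hbx hay.symm hxy.symm)
  -- The degree sum is at least `2 k #A`, and `#B ≤ #A`.
  · refine le_avgDeg_induce (hne.mono Finset.subset_union_left) ?_
    have h1 := sum_card_nbrs_union_ge (G := G) hAB
    have h2 : ∑ b ∈ B, (#(G.nbrs A b) : ℝ) = ∑ a ∈ A, (#(G.nbrs B a) : ℝ) := by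
      exact_mod_cast sum_card_nbrs_comm B A
    rw [h2, Finset.sum_congr rfl fun a ha => by rw [hk a ha], Finset.sum_const, nsmul_eq_mul] at h1
    refine le_trans ?_ h1
    rw [Finset.card_union_of_disjoint hAB]
    push_cast
    have h3 : (#B : ℝ) ≤ #A := by exact_mod_cast hc
    have h4 : (k : ℝ) * #B ≤ k * #A := by gcongr
    linarith
  · refine IsBipartiteWith.isBipartite (s := {v | (v : V) ∈ A}) (t := {v | (v : V) ∈ B}) ⟨?_, ?_⟩
    · rw [Set.disjoint_left]
      exact fun v h1 h2 => hnot v h1 h2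
    · intro v w h
      exact hcross v v.2 w w.2 h

end Conversion

/-! ### Numerical estimates for `d` and `Q` -/

section Parameters

variable {s k : ℕ} {d δ Q : ℝ}

/-- The source of the constant `10 ^ 6`: the exponents multiply to `(10 ^ 6 s ^ 3 / δ) (δ / (1000
s)) = 1000 s ^ 2`. -/
lemma pow_le_param (hs : 2 ≤ s) (hk : 2 ≤ k) (hδ : 0 < δ)
    (hd : ((k : ℝ) / δ) ^ ((10 : ℝ) ^ 6 * (s : ℝ) ^ 3 / δ) ≤ d) :
    ((k : ℝ) / δ) ^ (1000 * s ^ 2) ≤ d ^ (δ / (1000 * (s : ℝ))) := by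
  have hs0 : (0 : ℝ) < s := by exact_mod_cast (by omega : 0 < s)
  have hk0 : (0 : ℝ) < k := by exact_mod_cast (by omega : 0 < k)
  have hx : 0 < (k : ℝ) / δ := by positivity
  calc ((k : ℝ) / δ) ^ (1000 * s ^ 2)
      = (((k : ℝ) / δ) ^ ((10 : ℝ) ^ 6 * (s : ℝ) ^ 3 / δ)) ^ (δ / (1000 * (s : ℝ))) := by
        rw [← Real.rpow_mul hx.le, ← Real.rpow_natCast]
        congr 1
        push_cast
        field_simp
        norm_num
    _ ≤ d ^ (δ / (1000 * (s : ℝ))) := Real.rpow_le_rpow (by positivity) hd (by positivity)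

lemma forty_le_ratio (hk : 2 ≤ k) (hδ : 0 < δ) (hδ' : δ < 1 / 20) :
    40 ≤ (k : ℝ) / δ ∧ 20 * (k : ℝ) ≤ k / δ := by
  have hk0 : (2 : ℝ) ≤ k := by exact_mod_cast hk
  have h : 20 * (k : ℝ) ≤ k / δ := by
    rw [le_div_iff₀ hδ]
    nlinarith
  exact ⟨by linarith, h⟩

lemma pow_ratio_le (hk : 2 ≤ k) (hδ : 0 < δ) (hδ' : δ < 1 / 20)
    (hQ : ((k : ℝ) / δ) ^ (1000 * s ^ 2) ≤ Q) {n : ℕ} (hn : n ≤ 1000 * s ^ 2) :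
    ((k : ℝ) / δ) ^ n ≤ Q :=
  (pow_le_pow_right₀ (by linarith [(forty_le_ratio hk hδ hδ').1]) hn).trans hQ

lemma param_bounds (hs : 2 ≤ s) (hk : 2 ≤ k) (hδ : 0 < δ) (hδ' : δ < 1 / 20)
    (hQ : ((k : ℝ) / δ) ^ (1000 * s ^ 2) ≤ Q) :
    1000 ≤ Q ∧ (k : ℝ) ≤ Q ∧ 14 * (2 * k : ℝ) ^ s ≤ Q ∧ 1 + (k : ℝ) ^ 2 ≤ Q := by
  obtain ⟨hx, hxk⟩ := forty_le_ratio hk hδ hδ'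
  have hk0 : (2 : ℝ) ≤ k := by exact_mod_cast hk
  have hs2 : s ≤ s ^ 2 := Nat.le_self_pow (by norm_num) s
  have h2 := pow_ratio_le hk hδ hδ' hQ (n := 2) (by omega)
  have hs1 := pow_ratio_le hk hδ hδ' hQ (n := s + 1) (by omega)
  refine ⟨by nlinarith, by nlinarith, le_trans ?_ hs1, by nlinarith⟩
  rw [pow_succ, mul_comm]
  gcongr
  · linarith
  · linarith

lemma pow_param_le (hs : 2 ≤ s) (hδ : 0 < δ) (hδ' : δ < 1 / 20) (hQ : 1 ≤ Q)
    (hdQ : d = Q ^ (1000 * (s : ℝ) / δ)) {n : ℕ} (hn : n ≤ 20000 * s) : Q ^ n ≤ d := by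
  have hs0 : (0 : ℝ) < s := by exact_mod_cast (by omega : 0 < s)
  rw [hdQ, ← Real.rpow_natCast]
  refine Real.rpow_le_rpow_of_exponent_le hQ ?_
  have h1 : (n : ℝ) ≤ 20000 * s := by exact_mod_cast hn
  refine h1.trans ?_
  rw [le_div_iff₀ hδ]
  nlinarith

/-- In logarithms, `log d = (1000 s / δ) log Q` and `log Q ≤ 2 √Q`, while `√Q` also dominates the
remaining factor of order `s ^ 3 k / δ`. The exponent of `d` is the one that arises in
`unbalanced_param`. -/
lemma two_pow_param_ge (hs : 2 ≤ s) (hk : 2 ≤ k) (hδ : 0 < δ) (hδ' : δ < 1 / 20)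
    (hQ : ((k : ℝ) / δ) ^ (1000 * s ^ 2) ≤ Q) (hdQ : d = Q ^ (1000 * (s : ℝ) / δ)) :
    d ^ (2 * ((2 * s + 2 * k + 4) * s + 3)) ≤ 2 ^ Q := by
  obtain ⟨hQ1, -, -, -⟩ := param_bounds hs hk hδ hδ' hQ
  obtain ⟨hx, hxk⟩ := forty_le_ratio hk hδ hδ'
  have hQ0 : 0 < Q := by linarith
  have hs0 : (2 : ℝ) ≤ s := by exact_mod_cast hs
  have hk0 : (2 : ℝ) ≤ k := by exact_mod_cast hk
  have hd0 : 0 < d := by rw [hdQ]; positivity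
  set x : ℝ := k / δ with hxdef
  have hx0 : 0 < x := by linarith
  have hN : (2 * ((2 * s + 2 * k + 4) * s + 3) : ℝ) ≤ 8 * s ^ 2 * k := by
    nlinarith [mul_nonneg (sub_nonneg.2 hs0) (sub_nonneg.2 hk0),
      mul_nonneg (mul_nonneg (sub_nonneg.2 hs0) (sub_nonneg.2 hk0)) (sub_nonneg.2 hs0),
      sq_nonneg ((s : ℝ) - 2)]
  have hsq : x ^ (500 * s ^ 2) ≤ √Q := by
    refine Real.le_sqrt_of_sq_le ?_
    rw [← pow_mul]
    exact le_trans (le_of_eq (by congr 1; ring)) hQ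
  have hbig : 32000 * s ^ 3 * x ≤ √Q := by
    refine le_trans ?_ hsq
    have h1 : (s : ℝ) ≤ x ^ s := by
      have h2 : (s : ℝ) ≤ 2 ^ s := by exact_mod_cast Nat.lt_two_pow_self.le
      exact h2.trans (by gcongr; linarith)
    calc 32000 * (s : ℝ) ^ 3 * x ≤ x ^ 3 * (x ^ s) ^ 3 * x := by
          gcongr
          nlinarith [pow_le_pow_left₀ (by norm_num) hx 3]
      _ = x ^ (3 * s + 4) := by ring
      _ ≤ x ^ (500 * s ^ 2) := pow_le_pow_right₀ (by linarith) (by nlinarith)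
  have hlog : Real.log Q ≤ 2 * √Q := by
    have h1 := Real.log_le_self (Real.sqrt_nonneg Q)
    rw [Real.log_sqrt hQ0.le] at h1
    linarith
  rw [← Real.log_le_log_iff (by positivity) (by positivity), Real.log_pow,
    Real.log_rpow (by norm_num), hdQ, Real.log_rpow hQ0]
  have hlogQ : 0 ≤ Real.log Q := Real.log_nonneg (by linarith)
  have hlog2 : (1 / 2 : ℝ) ≤ Real.log 2 := by linarith [Real.log_two_gt_d9]
  push_cast
  calc (2 * ((2 * s + 2 * k + 4) * s + 3) : ℝ) * (1000 * s / δ * Real.log Q)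
      ≤ (8 * s ^ 2 * k) * (1000 * s / δ * (2 * √Q)) := by
        refine mul_le_mul hN (by gcongr) (mul_nonneg (by positivity) hlogQ) (by positivity)
    _ = (32000 * s ^ 3 * x) * √Q * (1 / 2) := by
        rw [hxdef]
        ring
    _ ≤ √Q * √Q * (1 / 2) := by gcongr
    _ = Q * (1 / 2) := by rw [Real.mul_self_sqrt hQ0.le]
    _ ≤ Q * Real.log 2 := by gcongr

/-- Every factor is at most a power of `D = d Q ^ 10 ≤ d ^ 2`, so the claim reduces to
`two_pow_param_ge`. -/
lemma unbalanced_param (hs : 2 ≤ s) (hk : 2 ≤ k) (hδ : 0 < δ) (hδ' : δ < 1 / 20)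
    (hQ : ((k : ℝ) / δ) ^ (1000 * s ^ 2) ≤ Q) (hdQ : d = Q ^ (1000 * (s : ℝ) / δ)) :
    (d * Q ^ 10 + 1) * (4 * (16 * Q ^ 10 * (2 * (d * Q ^ 10)) ^ s) * (d * Q ^ 10) * (1 + k ^ 2) *
      (2 * (d * Q ^ 10 + k * d)) ^ k) ^ s ≤ d * 2 ^ Q / 32 := by
  obtain ⟨hQ1, hkQ, -, hk2⟩ := param_bounds hs hk hδ hδ' hQ
  have hQ0 : 0 < Q := by linarith
  have hpow := two_pow_param_ge hs hk hδ hδ' hQ hdQ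
  have hd10 : Q ^ 10 ≤ d := pow_param_le hs hδ hδ' (by linarith) hdQ (by omega)
  have hQ10 : 1000 ≤ Q ^ 10 := hQ1.trans (le_self_pow₀ (by linarith) (by norm_num))
  have hQQ : Q ≤ Q ^ 10 := le_self_pow₀ (by linarith) (by norm_num)
  have hd1 : 1000 ≤ d := hQ10.trans hd10
  have hk0 : (0 : ℝ) ≤ k := by positivity
  set D := d * Q ^ 10 with hD
  have hDQ : Q ^ 10 ≤ D := by rw [hD]; nlinarith
  have hD1 : 1000 ≤ D := hQ10.trans hDQ
  have hDd : D ≤ d ^ 2 := by rw [hD, sq]; gcongr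
  have hkd : k * d ≤ D := by
    rw [hD, mul_comm]
    gcongr
    linarith
  clear_value D
  have hR : 4 * (16 * Q ^ 10 * (2 * D) ^ s) * D * (1 + k ^ 2) * (2 * (D + k * d)) ^ k
      ≤ D ^ (2 * s + 2 * k + 4) := by
    calc 4 * (16 * Q ^ 10 * (2 * D) ^ s) * D * (1 + k ^ 2) * (2 * (D + k * d)) ^ k
        = 64 * Q ^ 10 * (2 * D) ^ s * D * (1 + k ^ 2) * (2 * (D + k * d)) ^ k := by ring
      _ ≤ D * D * (D ^ 2) ^ s * D * D * (D ^ 2) ^ k := by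
          gcongr
          · linarith
          · nlinarith
          · linarith
          · nlinarith
      _ = D ^ (2 * s + 2 * k + 4) := by ring
  have hd0 : 0 < d := by linarith
  have h1 : 32 * ((D + 1) * (4 * (16 * Q ^ 10 * (2 * D) ^ s) * D * (1 + k ^ 2) *
      (2 * (D + k * d)) ^ k) ^ s) ≤ 2 ^ Q := by
    calc _ ≤ 32 * ((D + 1) * (D ^ (2 * s + 2 * k + 4)) ^ s) := by gcongr
      _ ≤ D ^ 3 * (D ^ (2 * s + 2 * k + 4)) ^ s := by
          rw [← mul_assoc]
          gcongr
          nlinarith [mul_pos (show 0 < D by linarith) (show 0 < D by linarith)]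
      _ = D ^ ((2 * s + 2 * k + 4) * s + 3) := by rw [← pow_mul, ← pow_add, add_comm]
      _ ≤ (d ^ 2) ^ ((2 * s + 2 * k + 4) * s + 3) := by gcongr
      _ = d ^ (2 * ((2 * s + 2 * k + 4) * s + 3)) := by rw [← pow_mul]
      _ ≤ 2 ^ Q := hpow
  have h2 : (2 : ℝ) ^ Q ≤ d * 2 ^ Q := by
    have : (0 : ℝ) < 2 ^ Q := by positivity
    nlinarith
  linarith

end Parameters

/-! ### The almost regular case and the theorem -/

section Main

variable {V : Type*} [Fintype V] {G : SimpleGraph V} {s k : ℕ} {d δ Q : ℝ}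

/-- With `y = Δ ^ (1 / (3 s))` and `p = y / (16 Δ)`, Kővári–Sós–Turán at `z = y ^ 3` makes `p ^ 3 Δ
Z` the constant `3 / 4096`. The sample has maximum degree at most `y` and average degree at least `y
/ (2 ^ 14 Q ^ 11)`, which is at least `y ^ (1 - δ)` because `y ^ δ ≥ Q ^ 14`. -/
lemma exists_sparse_of_almost_regular (hs : 2 ≤ s) (hk : 2 ≤ k) (hδ : 0 < δ) (hδ' : δ < 1 / 20)
    (hQ : ((k : ℝ) / δ) ^ (1000 * s ^ 2) ≤ Q) (hdQ : d = Q ^ (1000 * (s : ℝ) / δ))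
    (hG : G.NoBiclique s) {H : Finset V} (hne : H.Nonempty)
    (hH : ∀ v ∈ H, (#(G.nbrs H v) : ℝ) ≤ 2 * (d * Q ^ 10))
    (hHd : d / (64 * Q) * #H ≤ ∑ v ∈ H, (#(G.nbrs H v) : ℝ)) :
    ∃ S : Finset V, (G.induce (S : Set V)).C3C4Free ∧ (k : ℝ) ≤ (G.induce (S : Set V)).avgDeg ∧
      ((G.induce (S : Set V)).maxDeg : ℝ) ^ (1 - δ) ≤ (G.induce (S : Set V)).avgDeg := by
  obtain ⟨hQ1, hkQ, -, -⟩ := param_bounds hs hk hδ hδ' hQ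
  have hQ0 : 0 < Q := by linarith
  have hs0 : (0 : ℝ) < s := by exact_mod_cast (by omega : 0 < s)
  have hk0 : (2 : ℝ) ≤ k := by exact_mod_cast hk
  have hd1 : 1 ≤ d := by
    have := pow_param_le hs hδ hδ' (by linarith) hdQ (n := 0) (by omega)
    simpa using this
  have hd0 : 0 < d := by linarith
  set Δ := 2 * (d * Q ^ 10) with hΔ
  have hQ10 : 1 ≤ Q ^ 10 := one_le_pow₀ (by linarith)
  have hdΔ : d ≤ Δ := by rw [hΔ]; nlinarith
  have hΔ1 : 1 ≤ Δ := hd1.trans hdΔ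
  have hΔ0 : 0 < Δ := by linarith
  set y : ℝ := Δ ^ (1 / (3 * (s : ℝ))) with hy
  have hy0 : 0 < y := by positivity
  have hyΔ : y ^ (3 * s) = Δ := by
    rw [hy, ← Real.rpow_natCast, ← Real.rpow_mul hΔ0.le]
    push_cast
    rw [one_div, inv_mul_cancel₀ (by positivity), Real.rpow_one]
  have hy1 : 1 ≤ y := Real.one_le_rpow hΔ1 (by positivity)
  have hyδ : Q ^ 14 ≤ y ^ δ := by
    calc Q ^ 14 ≤ Q ^ (1000 / 3 : ℝ) := by
          rw [← Real.rpow_natCast]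
          exact Real.rpow_le_rpow_of_exponent_le (by linarith) (by norm_num)
      _ = d ^ (1 / (3 * (s : ℝ)) * δ) := by
          rw [hdQ, ← Real.rpow_mul hQ0.le]
          congr 1
          field_simp
      _ ≤ Δ ^ (1 / (3 * (s : ℝ)) * δ) := Real.rpow_le_rpow hd0.le hdΔ (by positivity)
      _ = y ^ δ := by rw [hy, ← Real.rpow_mul hΔ0.le]
  have hy14 : Q ^ 14 ≤ y := hyδ.trans <| by
    conv_rhs => rw [← Real.rpow_one y]
    exact Real.rpow_le_rpow_of_exponent_le hy1 (by linarith)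
  have hyQ : 2 ^ 14 * Q ^ 11 * k ≤ Q ^ 14 := by
    calc 2 ^ 14 * Q ^ 11 * k ≤ Q ^ 2 * Q ^ 11 * Q := by
          gcongr
          nlinarith
      _ = Q ^ 14 := by ring
  have hQ14 : 1000 ≤ Q ^ 14 := hQ1.trans (le_self_pow₀ (by linarith) (by norm_num))
  have hpd : y / (16 * Δ) * (d / (64 * Q)) / 8 = y / (2 ^ 14 * Q ^ 11) := by
    rw [hΔ]
    field_simp
    norm_num
  clear_value Δ y
  have hmain : (k : ℝ) ≤ y / (2 ^ 14 * Q ^ 11) := by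
    rw [le_div_iff₀ (by positivity)]
    linarith
  have hmax : y ^ (1 - δ) ≤ y / (2 ^ 14 * Q ^ 11) := by
    rw [Real.rpow_sub hy0, Real.rpow_one]
    gcongr
    refine le_trans ?_ (hyQ.trans hyδ)
    have : 0 < 2 ^ 14 * Q ^ 11 := by positivity
    nlinarith
  have hy3 : s * y ^ 3 ≤ Δ := by
    have h1 : (s : ℝ) ≤ y ^ (3 * s - 3) := by
      have h2 : (s : ℝ) ≤ 2 ^ (s - 1) := by
        have : s ≤ 2 ^ (s - 1) := by
          have := Nat.lt_two_pow_self (n := s - 1)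
          omega
        exact_mod_cast this
      calc (s : ℝ) ≤ 2 ^ (s - 1) := h2
        _ ≤ y ^ (s - 1) := by gcongr; linarith
        _ ≤ y ^ (3 * s - 3) := pow_le_pow_right₀ hy1 (by omega)
    calc s * y ^ 3 ≤ y ^ (3 * s - 3) * y ^ 3 := by gcongr
      _ = Δ := by rw [← pow_add, ← hyΔ]; congr 1; omega
  have hyleΔ : y ≤ Δ := by
    rw [← hyΔ]
    exact le_self_pow₀ hy1 (by omega)
  obtain ⟨S, -, hSne, hSd, hSΔ, h3, h4⟩ := exists_C3C4_sparse (G := G) (X := H) (Δ := Δ)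
    (d := d / (64 * Q)) (p := y / (16 * Δ)) (Z := 3 * Δ ^ 2 / y ^ 3) hne hH hHd
    (fun Y Y' hY hY' => hG.sum_card_nbrs_le (by omega) (by positivity)
      (le_of_eq (by rw [← pow_mul, hyΔ])) hy3 hY hY')
    (by positivity)
    (by rw [div_le_one (by positivity)]; linarith)
    (by
      have : y / (16 * Δ) * Δ = y / 16 := by field_simp
      rw [this, le_div_iff₀ (by norm_num)]
      linarith)
    (by linarith)
    (by
      have : (y / (16 * Δ)) ^ 3 * Δ * (3 * Δ ^ 2 / y ^ 3) = 3 / 4096 := by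
        field_simp
        norm_num
      rw [this]
      norm_num)
  rw [hpd] at hSd
  have hK : 16 * (y / (16 * Δ) * Δ) = y := by field_simp
  rw [hK] at hSΔ
  have havg := le_avgDeg_induce hSne hSd
  refine ⟨S, c3c4Free_induce h3 h4, hmain.trans havg, le_trans ?_ (hmax.trans havg)⟩
  exact Real.rpow_le_rpow (Nat.cast_nonneg _) (maxDeg_induce_le hy0.le hSΔ) (by linarith)

end Main

end SimpleGraph

theorem theorem5p1 :
    ∃ C : ℝ, 0 < C ∧
      ∀ (s k : ℕ) (d δ : ℝ), 2 ≤ s → 2 ≤ k → 2 ≤ d → 0 < δ → δ < 1 / 20 →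
        ((k : ℝ) / δ) ^ (C * (s : ℝ) ^ 3 / δ) ≤ d →
        ∀ (V : Type*) [Fintype V] (G : SimpleGraph V),
          (completeBipartiteGraph (Fin s) (Fin s)).Free G →
          d ≤ G.avgDeg →
          (∃ S : Finset V,
            (G.induce (S : Set V)).C3C4Free ∧
            (k : ℝ) ≤ (G.induce (S : Set V)).avgDeg ∧
            (((G.induce (S : Set V)).maxDeg : ℝ) ^ (1 - δ) ≤ (G.induce (S : Set V)).avgDeg ∨
              (G.induce (S : Set V)).IsBipartite)) ∧
          ((G.maxDeg : ℝ) ≤ d * (2 : ℝ) ^ (d ^ (δ / (1000 * (s : ℝ)))) →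
            ∃ S : Finset V,
              (G.induce (S : Set V)).C3C4Free ∧
              (k : ℝ) ≤ (G.induce (S : Set V)).avgDeg ∧
              ((G.induce (S : Set V)).maxDeg : ℝ) ^ (1 - δ) ≤ (G.induce (S : Set V)).avgDeg) := by
  refine ⟨10 ^ 6, by norm_num, ?_⟩
  intro s k d₀ δ hs hk hd₀ hδ hδ' hd₀C V _ G hfree havg
  have hG := SimpleGraph.noBiclique_of_free hfree
  have hV : Nonempty V := by
    by_contra h
    rw [not_nonempty_iff] at h
    have : G.avgDeg = 0 := by simp [SimpleGraph.avgDeg]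
    linarith
  obtain ⟨X, hX, d, hGd, hmax, heq⟩ := G.exists_max_avg
  have hdd : d₀ ≤ d := havg.trans hGd
  have hd0 : 0 < d := by linarith
  have hs0 : (0 : ℝ) < s := by exact_mod_cast (by omega : 0 < s)
  -- The exponent matches the bound on `Δ(G)` in the second claim, with the maximal average degree
  -- `d ≥ d₀` in place of `d₀`.
  obtain ⟨Q, hQdef⟩ : ∃ Q : ℝ, Q = d ^ (δ / (1000 * (s : ℝ))) := ⟨_, rfl⟩
  have hQ : ((k : ℝ) / δ) ^ (1000 * s ^ 2) ≤ Q := by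
    rw [hQdef]
    exact SimpleGraph.pow_le_param hs hk hδ (hd₀C.trans hdd)
  have hdQ : d = Q ^ (1000 * (s : ℝ) / δ) := by
    rw [hQdef, ← Real.rpow_mul hd0.le]
    conv_lhs => rw [← Real.rpow_one d]
    congr 1
    field_simp
  obtain ⟨hQ1, hkQ, hkQs, -⟩ := SimpleGraph.param_bounds hs hk hδ hδ' hQ
  have hreg := SimpleGraph.exists_almost_regular_or hX hQ1 (by linarith) hmax heq
  refine ⟨?_, fun hΔ => ?_⟩
  · rcases hreg with ⟨H, -, hH, hHΔ, hHd⟩ | he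
    · obtain ⟨S, h1, h2, h3⟩ := SimpleGraph.exists_sparse_of_almost_regular hs hk hδ hδ' hQ hdQ hG
        hH hHΔ hHd
      exact ⟨S, h1, h2, Or.inl h3⟩
    · have hQs : Q ^ (s + 1) ≤ d :=
        SimpleGraph.pow_param_le hs hδ hδ' (by linarith) hdQ (by omega)
      have hs32 : 32 * (s : ℝ) ≤ Q ^ s := by
        have h1 : (s : ℝ) ≤ 2 ^ s := by exact_mod_cast Nat.lt_two_pow_self.le
        have h2 : (32 : ℝ) ≤ 32 ^ s := le_self_pow₀ (by norm_num) (by omega)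
        calc 32 * (s : ℝ) ≤ 32 ^ s * 2 ^ s := by gcongr
          _ = (64 : ℝ) ^ s := by rw [← mul_pow]; norm_num
          _ ≤ Q ^ s := by gcongr; linarith
      have hQs0 : 0 < Q ^ s := by positivity
      rw [pow_succ] at hQs
      obtain ⟨A, -, B, -, h1, h2, h3, h4, h5, h6, h7⟩ :=
        SimpleGraph.exists_bipartite_of_unbalanced (by omega) (by omega) hG hX (by linarith)
          (by linarith) hmax heq he (by nlinarith) (by nlinarith) hkQs rfl
          (SimpleGraph.unbalanced_param hs hk hδ hδ' hQ hdQ)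
      classical
      obtain ⟨e1, e2, e3⟩ := SimpleGraph.bipartite_piece h1 h2 h3 h4 h5 h6 h7
      exact ⟨_, e1, e2, Or.inr e3⟩
  · rcases hreg with ⟨H, -, hH, hHΔ, hHd⟩ | he
    · exact SimpleGraph.exists_sparse_of_almost_regular hs hk hδ hδ' hQ hdQ hG hH hHΔ hHd
    -- No degree exceeds `d₀ * 2 ^ (d₀ ^ (δ / (1000 s))) ≤ d * 2 ^ Q`, so the unbalanced case cannot
    -- occur.
    · have hempty : G.highDeg X (max (d * Q ^ 10) (d * 2 ^ Q)) = ∅ := by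
        rw [Finset.eq_empty_iff_forall_notMem]
        intro v hv
        have h1 := (max_lt_iff.1 (SimpleGraph.mem_highDeg.1 hv).2).2
        have h2 := SimpleGraph.card_nbrs_le_maxDeg (G := G) X v
        have h3 : d₀ * (2 : ℝ) ^ (d₀ ^ (δ / (1000 * (s : ℝ)))) ≤ d * 2 ^ Q := by
          rw [hQdef]
          gcongr
          norm_num
        linarith
      rw [hempty, Finset.sum_empty] at he
      have : 0 < (X.card : ℝ) * d / 8 := by
        have : (0 : ℝ) < X.card := by exact_mod_cast hX.card_pos
        exact div_pos (mul_pos this hd0) (by norm_num)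
      linarith
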